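/- Let $\mathbb R^5_1$ be $\mathbb R^5$ with $\langle x,y\rangle=\sum_{i=1}^4x^iy^i-x^5y^5$, let $\mathbb H^4=\{x:\langle x,x\rangle=-1,\ x^5>0\}$, and let $\iota:\mathbb H^4\to\mathbb R^5_1$ be the inclusion. Let $M$ be a connected smooth surface and $\varphi:M\to\mathbb H^4$ a smooth immersion; give $M$ the induced metric. Let $H$ be the mean curvature vector field of $\varphi$ and $f=|H|$. Assume that $\varphi$ is a PNMC biconservative immersion in the following sense: $f>0$ and $\operatorname{grad}f\neq0$ everywhere; $\nabla^\perp(H/|H|)=0$; the tangential part of the bitension field $\tau_2(\varphi)=-\Delta^\varphi\tau(\varphi)-\operatorname{trace}R^{\mathbb H^4}(\varphi_*,\tau(\varphi))\varphi_*$, $\tau(\varphi)=2H$, vanishes; and no non-empty open subset of $M$ is mapped into a totally geodesic hypersurface $\mathbb H^3\subset\mathbb H^4$. Then there are real constants $c\neq0$ and $C$ ($C$ and $c^2$ being uniquely determined by the surface) such that on all of $M$ $$|\operatorname{grad} f|=\tfrac43 f\sqrt{1+9Cf^{3/2}-9f^2-c^2f^3}>0 .$$ If $C>0$, then, writing $\Phi=\iota\circ\varphi$,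 every point $p\in M$ has a neighbourhood with local coordinates $(u,t)\in(-\varepsilon,\varepsilon)\times(-\delta,\delta)$ centred at $p$ in which $$\Phi(u,t)=\hat\sigma(u)+\frac1{\hat\kappa(u)}\bigl(\sin t\;\bar b_1+(\cos t-1)\,\bar b_2\bigr),$$ where: (i) the mean curvature function depends only on $u$, $f=f(u)>0$, and satisfies $f'=\frac43f\sqrt{1+9Cf^{3/2}-9f^2-c^2f^3}>0$; (ii) $\hat\kappa(u)=3\sqrt C\,f(u)^{3/4}$; (iii) $\bar b_1,\bar b_2\in\mathbb R^5_1$ are constant vectors with $\langle\bar b_1,\bar b_2\rangle=0$ and $\langle\bar b_1,\bar b_1\rangle=\langle\bar b_2,\bar b_2\rangle=1$; (iv) $\hat\sigma$ is a smooth curve parametrized by arc length which lies in the totally geodesic hypersurface $\mathbb H^3=\{x\in\mathbb H^4:\langle x,\bar b_1\rangle=0\}$; as a curve in this $\mathbb H^3$ it has curvature $\kappa=f\sqrt{1+c^2f}$ and torsion (second Frenet curvature, taken non-negative) $$\tau=\frac{2|c|\sqrt f}{3(1+c^2f)}\sqrt{1+9Cf^{3/2}-9f^2-c^2f^3};$$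 and $\langle\hat\sigma(u),\bar b_2\rangle=1/\hat\kappa(u)$. -/

import Mathlib

open scoped Manifold ContDiff

noncomputable section

namespace HypSurface

/-- The vector space underlying the Minkowski space `ℝ⁵₁`
(only its topology and smooth structure are used from Mathlib's Euclidean structure). -/
abbrev R51 : Type := EuclideanSpace ℝ (Fin 5)

/-- The coordinate plane on which surfaces are modelled. -/
abbrev Plane : Type := EuclideanSpace ℝ (Fin 2)

/-- The Lorentzian form `x¹y¹ + x²y² + x³y³ + x⁴y⁴ - x⁵y⁵`. -/
def lorentz (x y : R51) : ℝ :=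
  (∑ i : Fin 4, x i.castSucc * y i.castSucc) - x (Fin.last 4) * y (Fin.last 4)

/-- The hyperboloid model of `ℍ⁴`. -/
def H4 : Set R51 := {x | lorentz x x = -1 ∧ 0 < x (Fin.last 4)}

/-- The hypersurface `ℍ⁴ ∩ ν^⊥`; for spacelike `ν` these are exactly the totally geodesic
hyperbolic 3-spaces in `ℍ⁴`. -/
def H3 (ν : R51) : Set R51 := {x | x ∈ H4 ∧ lorentz x ν = 0}

section Local

/-! Local geometry of an immersion `X : Plane → ℍ⁴ ⊂ ℝ⁵₁` (only the germ of `X` at the point `q`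
matters), with the metric induced by `X`. -/

/-- Partial derivative in the `i`-th coordinate direction. -/
def pd {F : Type*} [NormedAddCommGroup F] [NormedSpace ℝ F] (i : Fin 2) (V : Plane → F) :
    Plane → F :=
  fun q => fderiv ℝ V q (EuclideanSpace.single i 1)

/-- The first fundamental form `g_{ij} = ⟨∂ᵢX, ∂ⱼX⟩`. -/
def gram (X : Plane → R51) (q : Plane) : Matrix (Fin 2) (Fin 2) ℝ :=
  Matrix.of fun i j => lorentz (pd i X q) (pd j X q)

/-- The coefficients `g^{ij}` of the inverse metric. -/
def gInv (X : Plane → R51) (q : Plane) (i j : Fin 2) : ℝ := (gram X q)⁻¹ i j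

/-- Christoffel symbols `Γ^k_{ij}` of the Levi-Civita connection of the induced metric. -/
def christoffel (X : Plane → R51) (k i j : Fin 2) (q : Plane) : ℝ :=
  (1 / 2) * ∑ l : Fin 2, gInv X q k l *
    (pd i (fun x => gram X x j l) q + pd j (fun x => gram X x i l) q
      - pd l (fun x => gram X x i j) q)

/-- Orthogonal projection of `w` onto the tangent plane of the surface. -/
def tangPart (X : Plane → R51) (q : Plane) (w : R51) : R51 :=
  ∑ i : Fin 2, ∑ j : Fin 2, (gInv X q i j * lorentz w (pd i X q)) • pd j X q

/-- Orthogonal projection of `w` onto `T_x ℍ⁴ = x^⊥`, for `x ∈ ℍ⁴`. -/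
def hypProj (x w : R51) : R51 := w + lorentz w x • x

/-- Orthogonal projection of `w` onto the normal space of the surface in `ℍ⁴`. -/
def normPart (X : Plane → R51) (q : Plane) (w : R51) : R51 :=
  hypProj (X q) w - tangPart X q w

/-- Second fundamental form `B(∂ᵢ, ∂ⱼ)` of the surface in `ℍ⁴`. -/
def secondFF (X : Plane → R51) (i j : Fin 2) (q : Plane) : R51 :=
  normPart X q (pd i (pd j X) q)

/-- Mean curvature vector field `H = (trace B) / 2` in `ℍ⁴`. -/
def meanCurvVec (X : Plane → R51) (q : Plane) : R51 :=
  (1 / 2 : ℝ) • ∑ i : Fin 2, ∑ j : Fin 2, gInv X q i j • secondFF X i j q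

/-- Mean curvature function `|H|`. -/
def meanCurv (X : Plane → R51) (q : Plane) : ℝ :=
  √(lorentz (meanCurvVec X q) (meanCurvVec X q))

/-- Norm of the gradient of `h` with respect to the induced metric. -/
def gradNorm (X : Plane → R51) (h : Plane → ℝ) (q : Plane) : ℝ :=
  √(∑ i : Fin 2, ∑ j : Fin 2, gInv X q i j * pd i h q * pd j h q)

/-- Normal connection `∇^⊥_{∂ᵢ} V` of the surface in `ℍ⁴`, for a normal field `V`. -/
def normalConn (X : Plane → R51) (i : Fin 2) (V : Plane → R51) (q : Plane) : R51 :=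
  normPart X q (pd i V q)

/-- The connection induced on the pull-back of `Tℍ⁴`: `∇^φ_{∂ᵢ} V`. -/
def pullConn (X : Plane → R51) (i : Fin 2) (V : Plane → R51) (q : Plane) : R51 :=
  hypProj (X q) (pd i V q)

/-- Rough Laplacian `Δ^φ V = - trace (∇^φ ∇^φ - ∇^φ_∇) V`. -/
def roughLaplacian (X : Plane → R51) (V : Plane → R51) (q : Plane) : R51 :=
  -∑ i : Fin 2, ∑ j : Fin 2, gInv X q i j •
    (pullConn X i (pullConn X j V) q
      - ∑ k : Fin 2, christoffel X k i j q • pullConn X k V q)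

/-- Curvature tensor `R(x,y)z = -(⟨y,z⟩x - ⟨x,z⟩y)` of `ℍ⁴`, with the sign convention
`R(X,Y)Z = [∇_X, ∇_Y]Z - ∇_{[X,Y]}Z`. -/
def hypCurv (x y z : R51) : R51 := -(lorentz y z • x - lorentz x z • y)

/-- Tension field `τ(φ) = 2H`. -/
def tension (X : Plane → R51) (q : Plane) : R51 := (2 : ℝ) • meanCurvVec X q

/-- Bitension field `τ₂(φ) = -Δ^φ τ(φ) - trace R(φ_*, τ(φ)) φ_*`. -/
def bitension (X : Plane → R51) (q : Plane) : R51 :=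
  -roughLaplacian X (tension X) q
    - ∑ i : Fin 2, ∑ j : Fin 2, gInv X q i j • hypCurv (pd i X q) (tension X q) (pd j X q)

end Local

section Curves

/-! Frenet theory of a unit speed curve in a hyperboloid.  The formulas do not see the dimension
of the ambient hyperbolic space, so for a curve in the totally geodesic `H3 ν` they compute
the curvature and the torsion in that hyperbolic 3-space. -/

/-- Covariant derivative of `V` along the curve `σ`. -/
def curveCov (σ V : ℝ → R51) (u : ℝ) : R51 := hypProj (σ u) (deriv V u)

/-- Curvature `|∇_{σ'} σ'|` of a unit speed curve. -/
def curveCurvature (σ : ℝ → R51) (u : ℝ) : ℝ :=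
  √(lorentz (curveCov σ (deriv σ) u) (curveCov σ (deriv σ) u))

/-- Principal normal `N` of a unit speed curve. -/
def curveNormal (σ : ℝ → R51) (u : ℝ) : R51 :=
  (curveCurvature σ u)⁻¹ • curveCov σ (deriv σ) u

/-- The vector `∇_{σ'} N + κ σ'`. -/
def curveBinormalPart (σ : ℝ → R51) (u : ℝ) : R51 :=
  curveCov σ (curveNormal σ) u + curveCurvature σ u • deriv σ u

/-- Torsion (second Frenet curvature) `|∇_{σ'} N + κ σ'|` of a unit speed curve. -/
def curveTorsion (σ : ℝ → R51) (u : ℝ) : ℝ :=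
  √(lorentz (curveBinormalPart σ u) (curveBinormalPart σ u))

end Curves

section Global

variable {M : Type*} [TopologicalSpace M] [ChartedSpace Plane M]

/-- The (smooth) charts of the surface `M`. -/
def charts (M : Type*) [TopologicalSpace M] [ChartedSpace Plane M] :
    Set (OpenPartialHomeomorph M Plane) :=
  IsManifold.maximalAtlas (𝓡 2) ∞ M

/-- `Φ` is (the composition with the inclusion `ℍ⁴ ⊂ ℝ⁵₁` of) a PNMC biconservative immersion of
the surface `M` in `ℍ⁴`, under the standing non-degeneracy assumptions: positive mean curvature
function with nowhere vanishing gradient, and no open piece in a totally geodesic `ℍ³`. -/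
structure IsPNMCBiconservative (Φ : M → R51) : Prop where
  smooth : ContMDiff (𝓡 2) 𝓘(ℝ, R51) ∞ Φ
  mem_H4 : ∀ p, Φ p ∈ H4
  immersion : ∀ p, Function.Injective (mfderiv (𝓡 2) 𝓘(ℝ, R51) Φ p)
  meanCurv_pos : ∀ e ∈ charts M, ∀ q ∈ e.target, 0 < meanCurv (Φ ∘ e.symm) q
  grad_ne_zero : ∀ e ∈ charts M, ∀ q ∈ e.target, gradNorm (Φ ∘ e.symm) (meanCurv (Φ ∘ e.symm)) q ≠ 0
  parallel : ∀ e ∈ charts M, ∀ q ∈ e.target, ∀ i : Fin 2,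
    normalConn (Φ ∘ e.symm) i
      (fun x => (meanCurv (Φ ∘ e.symm) x)⁻¹ • meanCurvVec (Φ ∘ e.symm) x) q = 0
  biconservative : ∀ e ∈ charts M, ∀ q ∈ e.target,
    tangPart (Φ ∘ e.symm) q (bitension (Φ ∘ e.symm) q) = 0
  full : ∀ V : Set M, IsOpen V → V.Nonempty →
    ¬ ∃ ν : R51, 0 < lorentz ν ν ∧ ∀ p ∈ V, Φ p ∈ H3 ν

/-- The function `y ↦ 1 + 9C y^{3/2} - 9y² - c²y³`. -/
def radicand (c C y : ℝ) : ℝ := 1 + 9 * C * y ^ (3 / 2 : ℝ) - 9 * y ^ 2 - c ^ 2 * y ^ 3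

/-- The first integral `|grad f| = (4/3) f √(1 + 9C f^{3/2} - 9f² - c²f³) > 0` satisfied by the
mean curvature function `f` on the whole of `M`; it determines `c²` and `C`. -/
def HasFirstIntegral (Φ : M → R51) (c C : ℝ) : Prop :=
  ∀ e ∈ charts M, ∀ q ∈ e.target,
    0 < radicand c C (meanCurv (Φ ∘ e.symm) q) ∧
    gradNorm (Φ ∘ e.symm) (meanCurv (Φ ∘ e.symm)) q =
      (4 / 3) * meanCurv (Φ ∘ e.symm) q * √(radicand c C (meanCurv (Φ ∘ e.symm) q))

end Global

end HypSurface

end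

/-! Work with an orthonormal frame `v, w`, where `v = grad f / |grad f|`, and differentiate
everything as maps into flat `ℝ⁵₁`. Write `E₁ = D_v X`, `E₂ = D_w X`, `N = H/|H|`. The Gauss,
Codazzi and Ricci equations then need no separate treatment: all are instances of the commutator
formula for `D_v`, `D_w` applied to `X`, `N`, `E₁`, `E₂`.

Since `N` is parallel, Codazzi turns the divergence of its shape operator into the gradient of its
trace, and the biconservative equation says that `grad f` is an eigenvector. Hence `D_v N = f E₁`
and `D_w N = -3f E₂` (`IsBiconservativeFrame.shape`). The two eigenvalues differ, so the commutator
on `N` fixes the rest (`connection`): `D_v E₂ = 0`, `D_w E₁ = -b E₂`, `[v,w] = b w`, with `b = 3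
v(f) / (4f)`.

The only remaining unknown is the part `L` of the second fundamental form orthogonal to `N`
(`normalComponent`). Put `W = D_w E₂ = 3f N + X + b E₁ - L`. The equations `v|W|² = 2b|W|²` and
`v|L|² = 4b|L|²`, with both functions constant along `w`, compare with `v(f^p) = (4/3) p b f^p`. So
`|W|² = 9C f^(3/2)` and `|L|² = c² f³` (`exists_constants`), and Pythagoras for `W` is the first
integral. If `c` were `0`, then `X, E₁, E₂, N` would span a constant 4-space and the surface would
lie in an `ℍ³` (`exists_totallyGeodesic`). The first integral determines `c > 0` and `C` because `f`
is not locally constant (`constants_unique`); connectedness makes them global.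

When `C > 0`, the function `κ = |W| = 3√C f^(3/4)` satisfies `vκ = bκ` and `wκ = 0`, so `v` and
`κ⁻¹w` commute and are coordinate fields (`exists_adaptedChart`). In these coordinates `E₂` and
`W/κ` depend only on `t` and rotate at unit speed in a fixed spacelike plane, while `X + W/κ²`
depends only on `u`: the `t`-curves are circles (`rotation_const`). The curve `t = 0` is the
directrix, and its Frenet data are read off from `D_v E₁ - X = L - f N` (`v_principalNormal`). -/

noncomputable section

namespace HypSurface

/-! ### Algebra and signature of the Lorentzian form. -/

section Lorentz

lemma lorentz_comm (x y : R51) : lorentz x y = lorentz y x := by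
  simp only [lorentz, mul_comm]

lemma lorentz_add_left (x y z : R51) : lorentz (x + y) z = lorentz x z + lorentz y z := by
  simp only [lorentz, Fin.sum_univ_four, PiLp.add_apply]; ring

lemma lorentz_smul_left (r : ℝ) (x z : R51) : lorentz (r • x) z = r * lorentz x z := by
  simp only [lorentz, Fin.sum_univ_four, PiLp.smul_apply, smul_eq_mul]; ring

lemma lorentz_add_right (x y z : R51) : lorentz x (y + z) = lorentz x y + lorentz x z := by
  simp only [lorentz_comm x, lorentz_add_left]

lemma lorentz_smul_right (r : ℝ) (x z : R51) : lorentz x (r • z) = r * lorentz x z := by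
  simp only [lorentz_comm x, lorentz_smul_left]

/-- The Lorentzian form as a continuous bilinear map. -/
def lorentzL : R51 →L[ℝ] R51 →L[ℝ] ℝ :=
  (LinearMap.mk₂ ℝ lorentz lorentz_add_left lorentz_smul_left
    lorentz_add_right lorentz_smul_right).toContinuousBilinearMap

@[simp] lemma lorentzL_apply (x y : R51) : lorentzL x y = lorentz x y := rfl

lemma lorentz_zero_left (x : R51) : lorentz 0 x = 0 := by
  simpa using lorentz_smul_left 0 0 x

lemma lorentz_zero_right (x : R51) : lorentz x 0 = 0 := by
  rw [lorentz_comm, lorentz_zero_left]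

lemma lorentz_neg_left (x z : R51) : lorentz (-x) z = -lorentz x z := by
  simpa using lorentz_smul_left (-1) x z

lemma lorentz_neg_right (x z : R51) : lorentz x (-z) = -lorentz x z := by
  simpa using lorentz_smul_right (-1) x z

lemma lorentz_sub_left (x y z : R51) : lorentz (x - y) z = lorentz x z - lorentz y z := by
  simp only [sub_eq_add_neg, lorentz_add_left, lorentz_neg_left]

lemma lorentz_sub_right (x y z : R51) : lorentz x (y - z) = lorentz x y - lorentz x z := by
  simp only [sub_eq_add_neg, lorentz_add_right, lorentz_neg_right]

lemma lorentz_sum_left {ι : Type*} (s : Finset ι) (v : ι → R51) (z : R51) :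
    lorentz (∑ i ∈ s, v i) z = ∑ i ∈ s, lorentz (v i) z := by
  have := congrArg (fun L : R51 →L[ℝ] ℝ => L z) (map_sum lorentzL v s)
  rwa [_root_.sum_apply] at this

lemma lorentz_eq (x y : R51) :
    lorentz x y = x 0 * y 0 + x 1 * y 1 + x 2 * y 2 + x 3 * y 3 - x 4 * y 4 := by
  rw [lorentz, Fin.sum_univ_four]; rfl

/-- The Lorentzian form is positive definite on the orthogonal complement of a point of `ℍ⁴`. -/
lemma lorentz_self_pos {x w : R51} (hx : x ∈ H4) (hw : lorentz w x = 0) (hne : w ≠ 0) :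
    0 < lorentz w w := by
  obtain ⟨h1, h2⟩ := hx
  rw [lorentz_eq] at h1 hw ⊢
  change 0 < x 4 at h2
  have hext : ¬ (w 0 = 0 ∧ w 1 = 0 ∧ w 2 = 0 ∧ w 3 = 0 ∧ w 4 = 0) := by
    rintro ⟨h0, h1, h2, h3, h4⟩
    refine hne (PiLp.ext fun i => ?_)
    fin_cases i <;> assumption
  generalize x 0 = x0, x 1 = x1, x 2 = x2, x 3 = x3, x 4 = x4 at *
  generalize w 0 = w0, w 1 = w1, w 2 = w2, w 3 = w3, w 4 = w4 at *
  generalize hs : w0 * w0 + w1 * w1 + w2 * w2 + w3 * w3 = s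
  have hx4 : 0 < x4 * x4 := mul_pos h2 h2
  -- Cauchy–Schwarz for the spatial parts, through Lagrange's identity; orthogonality and `⟨x,x⟩ =
  -- -1` express its terms by the time components.
  have hcs : (w4 * x4) ^ 2 ≤ s * (x4 * x4 - 1) := by
    have e1 : w4 * x4 = w0 * x0 + w1 * x1 + w2 * x2 + w3 * x3 := by linarith
    have e2 : x4 * x4 - 1 = x0 * x0 + x1 * x1 + x2 * x2 + x3 * x3 := by linarith
    rw [e1, e2, ← hs]
    linarith [sq_nonneg (w0 * x1 - w1 * x0), sq_nonneg (w0 * x2 - w2 * x0),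
      sq_nonneg (w0 * x3 - w3 * x0), sq_nonneg (w1 * x2 - w2 * x1),
      sq_nonneg (w1 * x3 - w3 * x1), sq_nonneg (w2 * x3 - w3 * x2)]
  have hmul : s ≤ (s - w4 * w4) * (x4 * x4) := by linarith
  have a0 := mul_self_nonneg w0
  have a1 := mul_self_nonneg w1
  have a2 := mul_self_nonneg w2
  have a3 := mul_self_nonneg w3
  have hspos : 0 < s := by
    by_contra hcon
    have b0 : w0 = 0 := mul_self_eq_zero.1 (by linarith)
    have b1 : w1 = 0 := mul_self_eq_zero.1 (by linarith)
    have b2 : w2 = 0 := mul_self_eq_zero.1 (by linarith)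
    have b3 : w3 = 0 := mul_self_eq_zero.1 (by linarith)
    refine hext ⟨b0, b1, b2, b3, ?_⟩
    subst b0 b1 b2 b3
    have : w4 * x4 = 0 := by linarith
    exact (mul_eq_zero.1 this).resolve_right h2.ne'
  exact pos_of_mul_pos_left (hspos.trans_le hmul) hx4.le

lemma lorentz_self_nonneg {x w : R51} (hx : x ∈ H4) (hw : lorentz w x = 0) :
    0 ≤ lorentz w w := by
  by_cases h : w = 0
  · rw [h, lorentz_zero_left]
  · exact (lorentz_self_pos hx hw h).le

lemma eq_zero_of_lorentz_self {x w : R51} (hx : x ∈ H4) (hw : lorentz w x = 0)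
    (h : lorentz w w = 0) : w = 0 := by
  by_contra hne
  exact (lorentz_self_pos hx hw hne).ne' h

lemma lorentz_hypProj_of_orthogonal {x w v : R51} (hv : lorentz x v = 0) :
    lorentz (hypProj x w) v = lorentz w v := by
  rw [hypProj, lorentz_add_left, lorentz_smul_left, hv, mul_zero, add_zero]

end Lorentz

/-! ### Calculus of derivatives along vector fields of the plane. -/

section DirectionalDerivative

variable {F : Type*} [NormedAddCommGroup F] [NormedSpace ℝ F]

/-- Derivative of `V` along the vector field `v`. -/
def along (v : Plane → Plane) (V : Plane → F) : Plane → F := fun q => fderiv ℝ V q (v q)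

/-- Smoothness at every point of a set. -/
def SmoothAt (U : Set Plane) (V : Plane → F) : Prop := ∀ q ∈ U, ContDiffAt ℝ ∞ V q

variable {U : Set Plane} {v : Plane → Plane} {q : Plane}

lemma SmoothAt.diff {V : Plane → F} (h : SmoothAt U V) (hq : q ∈ U) : DifferentiableAt ℝ V q :=
  (h q hq).differentiableAt (by simp)

lemma SmoothAt.fderiv {V : Plane → F} (h : SmoothAt U V) : SmoothAt U (fderiv ℝ V) :=
  fun q hq => (h q hq).fderiv_right (m := ∞) (by simp)

lemma SmoothAt.along {V : Plane → F} (h : SmoothAt U V) (hv : SmoothAt U v) :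
    SmoothAt U (along v V) :=
  fun q hq => (h.fderiv q hq).clm_apply (hv q hq)

lemma SmoothAt.add {V W : Plane → F} (h : SmoothAt U V) (h' : SmoothAt U W) :
    SmoothAt U (fun q => V q + W q) := fun q hq => (h q hq).add (h' q hq)

lemma SmoothAt.sub {V W : Plane → F} (h : SmoothAt U V) (h' : SmoothAt U W) :
    SmoothAt U (fun q => V q - W q) := fun q hq => (h q hq).sub (h' q hq)

lemma SmoothAt.neg {V : Plane → F} (h : SmoothAt U V) :
    SmoothAt U (fun q => - V q) := fun q hq => (h q hq).neg

lemma SmoothAt.smul {g : Plane → ℝ} {V : Plane → F} (h : SmoothAt U g) (h' : SmoothAt U V) :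
    SmoothAt U (fun q => g q • V q) := fun q hq => (h q hq).smul (h' q hq)

lemma SmoothAt.mul {g h : Plane → ℝ} (hg : SmoothAt U g) (hh : SmoothAt U h) :
    SmoothAt U (fun q => g q * h q) := fun q hq => (hg q hq).mul (hh q hq)

lemma SmoothAt.inv {g : Plane → ℝ} (hg : SmoothAt U g) (h0 : ∀ q ∈ U, g q ≠ 0) :
    SmoothAt U (fun q => (g q)⁻¹) := fun q hq => (hg q hq).inv (h0 q hq)

lemma SmoothAt.sqrt {g : Plane → ℝ} (hg : SmoothAt U g) (h0 : ∀ q ∈ U, g q ≠ 0) :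
    SmoothAt U (fun q => √(g q)) := fun q hq => (hg q hq).sqrt (h0 q hq)

lemma SmoothAt.rpow {g : Plane → ℝ} (hg : SmoothAt U g) (h0 : ∀ q ∈ U, g q ≠ 0) (p : ℝ) :
    SmoothAt U (fun q => g q ^ p) := fun q hq => (hg q hq).rpow_const_of_ne (h0 q hq)

lemma SmoothAt.const (c : F) : SmoothAt U (fun _ => c) := fun _ _ => contDiffAt_const

lemma SmoothAt.sum {ι : Type*} (s : Finset ι) {V : ι → Plane → F} (h : ∀ i, SmoothAt U (V i)) :
    SmoothAt U (fun q => ∑ i ∈ s, V i q) := fun q hq => ContDiffAt.sum fun i _ => h i q hq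

lemma SmoothAt.lorentz {V W : Plane → R51} (h : SmoothAt U V) (h' : SmoothAt U W) :
    SmoothAt U (fun q => lorentz (V q) (W q)) := fun q hq =>
  (lorentzL.contDiff.contDiffAt.comp q (h q hq)).clm_apply (h' q hq)

lemma SmoothAt.pd {V : Plane → F} (h : SmoothAt U V) (i : Fin 2) : SmoothAt U (pd i V) :=
  h.along (.const _)

lemma SmoothAt.mono {V : Plane → F} {U' : Set Plane} (h : SmoothAt U V) (hU : U' ⊆ U) :
    SmoothAt U' V := fun q hq => h q (hU hq)

lemma along_congr {V W : Plane → F} (hU : IsOpen U) (hq : q ∈ U) (h : ∀ q ∈ U, V q = W q) :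
    along v V q = along v W q := by
  have : V =ᶠ[nhds q] W := Filter.eventually_of_mem (hU.mem_nhds hq) h
  rw [along, along, this.fderiv_eq]

lemma along_const (c : F) : along v (fun _ => c) q = 0 := by simp [along]

lemma along_add {V W : Plane → F} (h : DifferentiableAt ℝ V q) (h' : DifferentiableAt ℝ W q) :
    along v (fun q => V q + W q) q = along v V q + along v W q := by
  simp only [along, fderiv_fun_add h h', _root_.add_apply]

lemma along_sub {V W : Plane → F} (h : DifferentiableAt ℝ V q) (h' : DifferentiableAt ℝ W q) :
    along v (fun q => V q - W q) q = along v V q - along v W q := by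
  simp only [along, fderiv_fun_sub h h', _root_.sub_apply]

lemma along_neg {V : Plane → F} :
    along v (fun q => - V q) q = - along v V q := by
  simp only [along, fderiv_fun_neg, _root_.neg_apply]

lemma along_smul {g : Plane → ℝ} {V : Plane → F} (h : DifferentiableAt ℝ g q)
    (h' : DifferentiableAt ℝ V q) :
    along v (fun q => g q • V q) q = along v g q • V q + g q • along v V q := by
  simp only [along, fderiv_fun_smul h h', _root_.add_apply,
    _root_.smul_apply, ContinuousLinearMap.smulRight_apply]
  rw [add_comm]

lemma along_mul {g h : Plane → ℝ} (hg : DifferentiableAt ℝ g q) (hh : DifferentiableAt ℝ h q) :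
    along v (fun q => g q * h q) q = along v g q * h q + g q * along v h q :=
  along_smul hg hh

lemma along_comp {g : Plane → ℝ} {φ : ℝ → ℝ} {φ' : ℝ} (hφ : HasDerivAt φ φ' (g q))
    (hg : DifferentiableAt ℝ g q) :
    along v (fun q => φ (g q)) q = φ' * along v g q := by
  have := (hφ.comp_hasFDerivAt q hg.hasFDerivAt).fderiv
  simp only [Function.comp_def] at this
  simp [along, this]

lemma along_lorentz {V W : Plane → R51} (h : DifferentiableAt ℝ V q)
    (h' : DifferentiableAt ℝ W q) :
    along v (fun q => lorentz (V q) (W q)) q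
      = lorentz (along v V q) (W q) + lorentz (V q) (along v W q) := by
  have h1 : HasFDerivAt (fun q => lorentzL (V q)) (lorentzL.comp (fderiv ℝ V q)) q :=
    lorentzL.hasFDerivAt.comp q h.hasFDerivAt
  have := (h1.clm_apply h'.hasFDerivAt).fderiv
  simp only [lorentzL_apply] at this
  rw [along, this]
  simp [along, add_comm]

/-- Commutator of the derivatives along two vector fields. -/
lemma along_comm {V : Plane → F} {w : Plane → Plane} (h : ContDiffAt ℝ ∞ V q)
    (hv : DifferentiableAt ℝ v q) (hw : DifferentiableAt ℝ w q) :
    along v (along w V) q - along w (along v V) q =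
      fderiv ℝ V q (VectorField.lieBracket ℝ v w q) :=
  (VectorField.fderiv_apply_lieBracket (n := ∞) h
    (by simpa using (WithTop.coe_le_coe.2 le_top : ((2 : ℕ∞) : ℕ∞ω) ≤ ∞)) hw hv).symm

lemma along_along {V : Plane → F} (h : ContDiffAt ℝ ∞ V q) (hv : DifferentiableAt ℝ v q) :
    along v (along v V) q =
      fderiv ℝ (fderiv ℝ V) q (v q) (v q) + fderiv ℝ V q (fderiv ℝ v q (v q)) := by
  have h1 : DifferentiableAt ℝ (fderiv ℝ V) q :=
    (h.fderiv_right (m := 1) (by norm_cast)).differentiableAt (by simp)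
  unfold along
  rw [fderiv_clm_apply h1 hv]
  simp [add_comm]

end DirectionalDerivative

/-! ### Coordinate traces and projections computed in an orthonormal basis. -/

section OrthonormalBasis

variable {F : Type*} [NormedAddCommGroup F] [NormedSpace ℝ F]

lemma plane_eq (v : Plane) :
    v = v 0 • EuclideanSpace.single 0 1 + v 1 • EuclideanSpace.single 1 1 := by
  ext i; fin_cases i <;> simp

lemma fderiv_eq_pd (V : Plane → F) (q v : Plane) :
    fderiv ℝ V q v = v 0 • pd 0 V q + v 1 • pd 1 V q := by
  conv_lhs => rw [plane_eq v]
  rw [map_add, map_smul, map_smul]; rfl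

/-- The vectors `v`, `w` form an orthonormal basis for the metric induced by `X` at `q`. -/
structure OrthonormalAt (X : Plane → R51) (q v w : Plane) : Prop where
  left : lorentz (fderiv ℝ X q v) (fderiv ℝ X q v) = 1
  right : lorentz (fderiv ℝ X q w) (fderiv ℝ X q w) = 1
  cross : lorentz (fderiv ℝ X q v) (fderiv ℝ X q w) = 0

variable {X : Plane → R51} {q v w : Plane}

lemma gram_comm (i j : Fin 2) : gram X q i j = gram X q j i := lorentz_comm _ _

lemma lorentz_fderiv (u v : Plane) : lorentz (fderiv ℝ X q u) (fderiv ℝ X q v) =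
    u 0 * v 0 * gram X q 0 0 + u 0 * v 1 * gram X q 0 1 + u 1 * v 0 * gram X q 1 0
      + u 1 * v 1 * gram X q 1 1 := by
  simp only [fderiv_eq_pd X q, lorentz_add_left, lorentz_add_right, lorentz_smul_left,
    lorentz_smul_right, gram, Matrix.of_apply]
  ring

/-- If `P` has columns `v, w`, orthonormality reads `Pᵀ G P = 1`. One-sided inverses of square
matrices are two-sided, so `P Pᵀ G = 1`, which identifies the inverse metric. -/
lemma OrthonormalAt.mul_gram (h : OrthonormalAt X q v w) :
    (Matrix.of fun i j => v i * v j + w i * w j) * gram X q = 1 := by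
  have h1 : (Matrix.of ![![v 0, v 1], ![w 0, w 1]])
      * (gram X q * (Matrix.of ![![v 0, w 0], ![v 1, w 1]])) = 1 := by
    have a := h.left
    have b := h.right
    have c := h.cross
    rw [lorentz_fderiv] at a b c
    have hc := gram_comm (X := X) (q := q) 0 1
    ext i j
    fin_cases i <;> fin_cases j <;> simp [Matrix.mul_apply, Fin.sum_univ_two]
    · linear_combination a
    · linear_combination c
    · linear_combination c + (v 1 * w 0 - v 0 * w 1) * hc
    · linear_combination b
  rw [mul_eq_one_comm, Matrix.mul_assoc, mul_eq_one_comm] at h1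
  rw [← h1]
  congr 1
  ext i j
  fin_cases i <;> fin_cases j <;> simp [Matrix.mul_apply, Fin.sum_univ_two]

lemma OrthonormalAt.gInv_eq (h : OrthonormalAt X q v w) (i j : Fin 2) :
    gInv X q i j = v i * v j + w i * w j := by
  rw [gInv, Matrix.inv_eq_left_inv h.mul_gram, Matrix.of_apply]

lemma OrthonormalAt.tangPart_eq (h : OrthonormalAt X q v w) (x : R51) :
    tangPart X q x = lorentz x (fderiv ℝ X q v) • fderiv ℝ X q v
      + lorentz x (fderiv ℝ X q w) • fderiv ℝ X q w := by
  simp only [tangPart, h.gInv_eq, Fin.sum_univ_two, fderiv_eq_pd X q, lorentz_add_right,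
    lorentz_smul_right]
  module

/-- Invariance of the metric trace; this converts the coordinate definitions of the mean curvature
vector and the rough Laplacian into frame expressions. -/
lemma OrthonormalAt.sum_gInv_smul (h : OrthonormalAt X q v w) (B : Plane →L[ℝ] Plane →L[ℝ] F) :
    ∑ i : Fin 2, ∑ j : Fin 2,
      gInv X q i j • B (EuclideanSpace.single i 1) (EuclideanSpace.single j 1)
      = B v v + B w w := by
  conv_rhs => rw [plane_eq v, plane_eq w]
  simp only [h.gInv_eq, Fin.sum_univ_two, map_add, map_smul, _root_.add_apply,
    _root_.smul_apply]
  module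

lemma OrthonormalAt.gradNorm_eq (h : OrthonormalAt X q v w) (g : Plane → ℝ) :
    gradNorm X g q = √(fderiv ℝ g q v ^ 2 + fderiv ℝ g q w ^ 2) := by
  simp only [gradNorm, h.gInv_eq, Fin.sum_univ_two, fderiv_eq_pd g q, smul_eq_mul]
  congr 1
  ring

lemma OrthonormalAt.eq_frame (h : OrthonormalAt X q v w) (u : Plane) :
    u = lorentz (fderiv ℝ X q u) (fderiv ℝ X q v) • v
      + lorentz (fderiv ℝ X q u) (fderiv ℝ X q w) • w := by
  have h1 := h.mul_gram
  have e (i j : Fin 2) := congrFun (congrFun h1 i) j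
  simp only [Matrix.mul_apply, Fin.sum_univ_two, Matrix.of_apply] at e
  rw [lorentz_fderiv, lorentz_fderiv]
  have hc := gram_comm (X := X) (q := q) 0 1
  have e00 := e 0 0
  have e01 := e 0 1
  have e10 := e 1 0
  have e11 := e 1 1
  rw [Matrix.one_apply_eq] at e00 e11
  rw [Matrix.one_apply_ne (by decide)] at e01 e10
  refine PiLp.ext fun i => ?_
  fin_cases i
  · simp
    linear_combination -u 0 * e00 - u 1 * e01 + (u 1 * (v 0 * v 0 + w 0 * w 0) - u 0 * (v 0 * v 1 + w 0 * w 1)) * hc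
  · simp
    linear_combination -u 0 * e10 - u 1 * e11 + (u 1 * (v 0 * v 1 + w 0 * w 1) - u 0 * (v 1 * v 1 + w 1 * w 1)) * hc

lemma normPart_add (x y : R51) : normPart X q (x + y) = normPart X q x + normPart X q y := by
  simp only [normPart, hypProj, tangPart, lorentz_add_left, Fin.sum_univ_two]
  module

lemma normPart_smul (r : ℝ) (x : R51) : normPart X q (r • x) = r • normPart X q x := by
  simp only [normPart, hypProj, tangPart, lorentz_smul_left, Fin.sum_univ_two]
  module

/-- `normPart` as a continuous linear map. -/
def normPartL (X : Plane → R51) (q : Plane) : R51 →L[ℝ] R51 :=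
  LinearMap.toContinuousLinearMap
    { toFun := normPart X q
      map_add' := normPart_add
      map_smul' := normPart_smul }

@[simp] lemma normPartL_apply (x : R51) : normPartL X q x = normPart X q x := rfl

lemma pd_pd_eq {V : Plane → F} (hX : ContDiffAt ℝ ∞ V q) (i j : Fin 2) :
    pd i (pd j V) q
      = fderiv ℝ (fderiv ℝ V) q (EuclideanSpace.single i 1) (EuclideanSpace.single j 1) := by
  have h1 : DifferentiableAt ℝ (fderiv ℝ V) q :=
    (hX.fderiv_right (m := 1) (by norm_cast)).differentiableAt (by simp)
  unfold pd
  rw [fderiv_clm_apply h1 (by fun_prop)]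
  simp

lemma OrthonormalAt.meanCurvVec_eq (h : OrthonormalAt X q v w) (hX : ContDiffAt ℝ ∞ X q) :
    meanCurvVec X q = (1 / 2 : ℝ) • (normPart X q (fderiv ℝ (fderiv ℝ X) q v v)
      + normPart X q (fderiv ℝ (fderiv ℝ X) q w w)) := by
  have := h.sum_gInv_smul
    (((ContinuousLinearMap.compL ℝ Plane R51 R51) (normPartL X q)).comp (fderiv ℝ (fderiv ℝ X) q))
  simp only [ContinuousLinearMap.comp_apply, ContinuousLinearMap.compL_apply,
    normPartL_apply] at this
  rw [meanCurvVec, ← this]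
  simp only [secondFF, pd_pd_eq hX]

lemma OrthonormalAt.normPart_fderiv (h : OrthonormalAt X q v w)
    (hX : ∀ u, lorentz (fderiv ℝ X q u) (X q) = 0) (u : Plane) :
    normPart X q (fderiv ℝ X q u) = 0 := by
  have : fderiv ℝ X q u = tangPart X q (fderiv ℝ X q u) := by
    conv_lhs => rw [h.eq_frame u]
    rw [h.tangPart_eq, map_add, map_smul, map_smul]
  rw [normPart, hypProj, hX, zero_smul, add_zero, sub_eq_zero]
  exact this

end OrthonormalBasis

/-! ### Behaviour of the invariants under a change of coordinates. -/

section ChangeOfCoordinates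

variable {X : Plane → R51} {ψ : Plane → Plane} {q v w : Plane}

lemma lorentz_fderiv_self (hX : ∀ᶠ x in nhds q, X x ∈ H4) (hd : DifferentiableAt ℝ X q)
    (u : Plane) : lorentz (fderiv ℝ X q u) (X q) = 0 := by
  have h1 : along (fun _ => u) (fun x => lorentz (X x) (X x)) q = 0 := by
    have : (fun x => lorentz (X x) (X x)) =ᶠ[nhds q] fun _ => (-1 : ℝ) :=
      hX.mono fun x hx => hx.1
    rw [along, this.fderiv_eq]; simp
  rw [along_lorentz hd hd, lorentz_comm (X q)] at h1
  simp only [along] at h1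
  linarith

lemma OrthonormalAt.comp (h : OrthonormalAt X (ψ q) (fderiv ℝ ψ q v) (fderiv ℝ ψ q w))
    (hX : DifferentiableAt ℝ X (ψ q)) (hψ : DifferentiableAt ℝ ψ q) :
    OrthonormalAt (X ∘ ψ) q v w := by
  have e (u : Plane) : fderiv ℝ (X ∘ ψ) q u = fderiv ℝ X (ψ q) (fderiv ℝ ψ q u) := by
    rw [fderiv_comp q hX hψ]; rfl
  constructor
  · rw [e]; exact h.left
  · rw [e]; exact h.right
  · rw [e, e]; exact h.cross

lemma fderiv_fderiv_comp (hX : ContDiffAt ℝ ∞ X (ψ q)) (hψ : ContDiffAt ℝ ∞ ψ q) (u : Plane) :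
    fderiv ℝ (fderiv ℝ (X ∘ ψ)) q u u =
      fderiv ℝ (fderiv ℝ X) (ψ q) (fderiv ℝ ψ q u) (fderiv ℝ ψ q u)
        + fderiv ℝ X (ψ q) (fderiv ℝ (fderiv ℝ ψ) q u u) := by
  have hX1 : DifferentiableAt ℝ (fderiv ℝ X) (ψ q) :=
    (hX.fderiv_right (m := 1) (by norm_cast)).differentiableAt (by simp)
  have hψ1 : DifferentiableAt ℝ (fderiv ℝ ψ) q :=
    (hψ.fderiv_right (m := 1) (by norm_cast)).differentiableAt (by simp)
  have hψ0 : DifferentiableAt ℝ ψ q := hψ.differentiableAt (by simp)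
  have h1 : fderiv ℝ (X ∘ ψ) =ᶠ[nhds q] fun x => (fderiv ℝ X (ψ x)).comp (fderiv ℝ ψ x) := by
    have a : ∀ᶠ x in nhds q, DifferentiableAt ℝ ψ x :=
      ((hψ.of_le (m := 1) (by norm_cast)).eventually (by simp)).mono
        fun x hx => hx.differentiableAt (by simp)
    have b : ∀ᶠ x in nhds (ψ q), DifferentiableAt ℝ X x :=
      ((hX.of_le (m := 1) (by norm_cast)).eventually (by simp)).mono
        fun x hx => hx.differentiableAt (by simp)
    filter_upwards [a, hψ0.continuousAt.eventually b] with x h1 h2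
    exact fderiv_comp x h2 h1
  have hc : DifferentiableAt ℝ (fun x => fderiv ℝ X (ψ x)) q := hX1.comp q hψ0
  have hc' : fderiv ℝ (fun x => fderiv ℝ X (ψ x)) q
      = (fderiv ℝ (fderiv ℝ X) (ψ q)).comp (fderiv ℝ ψ q) := fderiv_comp q hX1 hψ0
  rw [h1.fderiv_eq, fderiv_clm_comp hc hψ1, hc']
  simp [add_comm]

/-- The differential of `ψ` carries one orthonormal basis to the other, so the normal projections
agree. The second derivatives differ only by `dX(D²ψ)`, which is tangent and disappears under the
normal projection. -/
lemma OrthonormalAt.meanCurvVec_comp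
    (h : OrthonormalAt X (ψ q) (fderiv ℝ ψ q v) (fderiv ℝ ψ q w))
    (hX : ContDiffAt ℝ ∞ X (ψ q)) (hψ : ContDiffAt ℝ ∞ ψ q)
    (hH : ∀ᶠ x in nhds (ψ q), X x ∈ H4) :
    meanCurvVec (X ∘ ψ) q = meanCurvVec X (ψ q) := by
  have hψ0 : DifferentiableAt ℝ ψ q := hψ.differentiableAt (by simp)
  have hX0 : DifferentiableAt ℝ X (ψ q) := hX.differentiableAt (by simp)
  have h' := h.comp hX0 hψ0
  have e (u : Plane) : fderiv ℝ (X ∘ ψ) q u = fderiv ℝ X (ψ q) (fderiv ℝ ψ q u) := by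
    rw [fderiv_comp q hX0 hψ0]; rfl
  have hn (x : R51) : normPart (X ∘ ψ) q x = normPart X (ψ q) x := by
    rw [normPart, normPart, h.tangPart_eq, h'.tangPart_eq, e, e]; rfl
  rw [h.meanCurvVec_eq hX, h'.meanCurvVec_eq (hX.comp q hψ), hn, hn,
    fderiv_fderiv_comp hX hψ, fderiv_fderiv_comp hX hψ, normPart_add, normPart_add,
    h.normPart_fderiv (lorentz_fderiv_self hH hX0), h.normPart_fderiv (lorentz_fderiv_self hH hX0)]
  simp

lemma OrthonormalAt.gradNorm_comp
    (h : OrthonormalAt X (ψ q) (fderiv ℝ ψ q v) (fderiv ℝ ψ q w))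
    (hX : DifferentiableAt ℝ X (ψ q)) (hψ : DifferentiableAt ℝ ψ q) {g : Plane → ℝ}
    (hg : DifferentiableAt ℝ g (ψ q)) :
    gradNorm (X ∘ ψ) (g ∘ ψ) q = gradNorm X g (ψ q) := by
  rw [h.gradNorm_eq, (h.comp hX hψ).gradNorm_eq, fderiv_comp q hg hψ]; rfl

end ChangeOfCoordinates

/-! ### Smoothness of the induced geometry and the frame adapted to a gradient. -/

/-- `X` is a smooth immersion of the open set `U` in `ℍ⁴`. -/
structure IsImmersionOn (U : Set Plane) (X : Plane → R51) : Prop where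
  isOpen : IsOpen U
  smooth : SmoothAt U X
  mem_H4 : ∀ q ∈ U, X q ∈ H4
  injective : ∀ q ∈ U, ∀ v, fderiv ℝ X q v = 0 → v = 0

namespace IsImmersionOn

variable {U : Set Plane} {X : Plane → R51} {q : Plane}

lemma mono (h : IsImmersionOn U X) {U' : Set Plane} (ho : IsOpen U') (hU : U' ⊆ U) :
    IsImmersionOn U' X :=
  ⟨ho, h.smooth.mono hU, fun q hq => h.mem_H4 q (hU hq), fun q hq => h.injective q (hU hq)⟩

lemma lorentz_fderiv_self (h : IsImmersionOn U X) (hq : q ∈ U) (u : Plane) :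
    lorentz (fderiv ℝ X q u) (X q) = 0 :=
  HypSurface.lorentz_fderiv_self (Filter.eventually_of_mem (h.isOpen.mem_nhds hq) h.mem_H4)
    (h.smooth.diff hq) u

lemma lorentz_fderiv_pos (h : IsImmersionOn U X) (hq : q ∈ U) {u : Plane} (hu : u ≠ 0) :
    0 < lorentz (fderiv ℝ X q u) (fderiv ℝ X q u) :=
  lorentz_self_pos (h.mem_H4 q hq) (h.lorentz_fderiv_self hq u)
    fun h0 => hu (h.injective q hq u h0)

lemma gram_pos (h : IsImmersionOn U X) (hq : q ∈ U) : 0 < gram X q 0 0 :=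
  h.lorentz_fderiv_pos hq (u := EuclideanSpace.single 0 1) (by simp)

lemma det_gram_pos (h : IsImmersionOn U X) (hq : q ∈ U) : 0 < (gram X q).det := by
  have h1 := h.gram_pos hq
  -- This vector is orthogonal to the first coordinate vector, and its squared length is `g₀₀ det
  -- g`.
  have h2 := h.lorentz_fderiv_pos hq (u := WithLp.toLp 2 ![-gram X q 0 1, gram X q 0 0])
    (fun h0 => h1.ne' (by simpa using congrArg (fun v : Plane => v 1) h0))
  rw [lorentz_fderiv] at h2
  simp only [Matrix.cons_val_zero, Matrix.cons_val_one] at h2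
  rw [gram_comm 1 0] at h2
  rw [Matrix.det_fin_two, gram_comm 1 0]
  refine pos_of_mul_pos_left (b := gram X q 0 0) ?_ h1.le
  linarith

lemma smooth_gram (h : IsImmersionOn U X) (i j : Fin 2) : SmoothAt U fun q => gram X q i j :=
  (h.smooth.pd i).lorentz (h.smooth.pd j)

lemma smooth_det_gram (h : IsImmersionOn U X) : SmoothAt U fun q => (gram X q).det := by
  simp only [Matrix.det_fin_two]
  exact ((h.smooth_gram 0 0).mul (h.smooth_gram 1 1)).sub
    ((h.smooth_gram 0 1).mul (h.smooth_gram 1 0))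

lemma gInv_eq (i j : Fin 2) :
    gInv X q i j = (gram X q).det⁻¹ *
      !![gram X q 1 1, -gram X q 0 1; -gram X q 1 0, gram X q 0 0] i j := by
  rw [gInv, Matrix.inv_def, Matrix.adjugate_fin_two, Ring.inverse_eq_inv']; rfl

lemma smooth_gInv (h : IsImmersionOn U X) (i j : Fin 2) : SmoothAt U fun q => gInv X q i j := by
  simp only [gInv_eq]
  refine (h.smooth_det_gram.inv fun q hq => (h.det_gram_pos hq).ne').mul ?_
  fin_cases i <;> fin_cases j
  · exact h.smooth_gram 1 1
  · exact (h.smooth_gram 0 1).neg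
  · exact (h.smooth_gram 1 0).neg
  · exact h.smooth_gram 0 0

lemma smooth_tangPart (h : IsImmersionOn U X) {V : Plane → R51} (hV : SmoothAt U V) :
    SmoothAt U fun q => tangPart X q (V q) :=
  .sum _ fun i => .sum _ fun j =>
    ((h.smooth_gInv i j).mul (hV.lorentz (h.smooth.pd i))).smul (h.smooth.pd j)

lemma smooth_meanCurvVec (h : IsImmersionOn U X) : SmoothAt U (meanCurvVec X) :=
  SmoothAt.smul (.const _) <| .sum _ fun i => .sum _ fun j => (h.smooth_gInv i j).smul <| by
    have hV : SmoothAt U (pd i (pd j X)) := (h.smooth.pd j).pd i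
    exact (hV.add ((hV.lorentz h.smooth).smul h.smooth)).sub (h.smooth_tangPart hV)

lemma smooth_meanCurv (h : IsImmersionOn U X) (hf : ∀ q ∈ U, 0 < meanCurv X q) :
    SmoothAt U (meanCurv X) :=
  (h.smooth_meanCurvVec.lorentz h.smooth_meanCurvVec).sqrt fun q hq =>
    (Real.sqrt_pos.1 (hf q hq)).ne'

lemma smooth_gradNorm (h : IsImmersionOn U X) {f : Plane → ℝ} (hf : SmoothAt U f)
    (h0 : ∀ q ∈ U, gradNorm X f q ≠ 0) : SmoothAt U (gradNorm X f) := by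
  refine SmoothAt.sqrt (.sum _ fun i => .sum _ fun j =>
    ((h.smooth_gInv i j).mul (hf.pd i)).mul (hf.pd j)) fun q hq h1 => h0 q hq ?_
  rw [gradNorm, h1, Real.sqrt_zero]

/-- A smooth function with nowhere vanishing gradient has a smooth adapted orthonormal frame,
whose first vector is the normalized gradient. -/
lemma exists_frame (h : IsImmersionOn U X) {f : Plane → ℝ} (hf : SmoothAt U f)
    (h0 : ∀ q ∈ U, gradNorm X f q ≠ 0) :
    ∃ v w : Plane → Plane, SmoothAt U v ∧ SmoothAt U w ∧
      ∀ q ∈ U, OrthonormalAt X q (v q) (w q) ∧ along v f q = gradNorm X f q ∧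
        along w f q = 0 := by
  have hF := h.smooth_gradNorm hf h0
  have hFi := hF.inv h0
  have hdet : ∀ q ∈ U, √(gram X q).det ≠ 0 := fun q hq =>
    (Real.sqrt_pos.2 (h.det_gram_pos hq)).ne'
  have hd := (h.smooth_det_gram.sqrt fun q hq => (h.det_gram_pos hq).ne').inv hdet
  have hv : ∀ {a b : Plane → ℝ}, SmoothAt U a → SmoothAt U b →
      SmoothAt U fun q => (WithLp.toLp 2 ![a q, b q] : Plane) := by
    intro a b ha hb q hq
    rw [contDiffAt_euclidean]
    intro i
    fin_cases i
    · exact ha q hq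
    · exact hb q hq
  -- The first field is the gradient divided by its length. The second is the rotated differential
  -- `(-∂₁f, ∂₀f)`, which annihilates `f` and has length `√(det g) |grad f|`.
  refine ⟨fun q => WithLp.toLp 2
      ![(gradNorm X f q)⁻¹ * (gInv X q 0 0 * pd 0 f q + gInv X q 0 1 * pd 1 f q),
        (gradNorm X f q)⁻¹ * (gInv X q 1 0 * pd 0 f q + gInv X q 1 1 * pd 1 f q)],
    fun q => WithLp.toLp 2
      ![(√(gram X q).det)⁻¹ * (gradNorm X f q)⁻¹ * (-pd 1 f q),
        (√(gram X q).det)⁻¹ * (gradNorm X f q)⁻¹ * pd 0 f q], ?_, ?_, ?_⟩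
  · exact hv
      (hFi.mul (((h.smooth_gInv 0 0).mul (hf.pd 0)).add ((h.smooth_gInv 0 1).mul (hf.pd 1))))
      (hFi.mul (((h.smooth_gInv 1 0).mul (hf.pd 0)).add ((h.smooth_gInv 1 1).mul (hf.pd 1))))
  · exact hv ((hd.mul hFi).mul (hf.pd 1).neg) ((hd.mul hFi).mul (hf.pd 0))
  · intro q hq
    have hFq := h0 q hq
    have hD := h.det_gram_pos hq
    have hF2 : gradNorm X f q ^ 2 * (gram X q).det = gram X q 1 1 * pd 0 f q ^ 2
        - 2 * gram X q 0 1 * pd 0 f q * pd 1 f q + gram X q 0 0 * pd 1 f q ^ 2 := by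
      have : 0 < ∑ i : Fin 2, ∑ j : Fin 2, gInv X q i j * pd i f q * pd j f q :=
        Real.sqrt_pos.1 (lt_of_le_of_ne (Real.sqrt_nonneg _) (Ne.symm hFq))
      rw [gradNorm, Real.sq_sqrt this.le]
      simp only [Fin.sum_univ_two, gInv_eq, gram_comm 1 0]
      simp
      field_simp
      ring
    have hs2 : (√(gram X q).det) ^ 2 = (gram X q).det := Real.sq_sqrt hD.le
    have hdq := hdet q hq
    have hDe := Matrix.det_fin_two (gram X q)
    rw [gram_comm 1 0] at hDe
    refine ⟨⟨?_, ?_, ?_⟩, ?_, ?_⟩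
    · rw [lorentz_fderiv]
      simp only [Matrix.cons_val_zero, Matrix.cons_val_one, gInv_eq, gram_comm 1 0]
      simp
      generalize gradNorm X f q = F at *
      generalize (gram X q).det = D at *
      generalize gram X q 0 0 = a, gram X q 0 1 = b, gram X q 1 1 = c at *
      generalize pd 0 f q = x, pd 1 f q = y at *
      field_simp
      linear_combination -(c * x ^ 2 - 2 * b * x * y + a * y ^ 2) * hDe - D * hF2
    · rw [lorentz_fderiv]
      simp only [Matrix.cons_val_zero, Matrix.cons_val_one, gram_comm 1 0]
      generalize √(gram X q).det = s at *
      generalize gradNorm X f q = F at *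
      generalize (gram X q).det = D at *
      generalize gram X q 0 0 = a, gram X q 0 1 = b, gram X q 1 1 = c at *
      generalize pd 0 f q = x, pd 1 f q = y at *
      field_simp
      linear_combination -hF2 - F ^ 2 * hs2
    · rw [lorentz_fderiv]
      simp only [Matrix.cons_val_zero, Matrix.cons_val_one, gInv_eq, gram_comm 1 0]
      simp
      generalize √(gram X q).det = s at *
      generalize gradNorm X f q = F at *
      generalize (gram X q).det = D at *
      generalize gram X q 0 0 = a, gram X q 0 1 = b, gram X q 1 1 = c at *
      generalize pd 0 f q = x, pd 1 f q = y at *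
      field_simp
      ring
    · rw [along, fderiv_eq_pd]
      simp only [Matrix.cons_val_zero, Matrix.cons_val_one, gInv_eq, gram_comm 1 0]
      simp
      generalize gradNorm X f q = F at *
      generalize (gram X q).det = D at *
      generalize gram X q 0 0 = a, gram X q 0 1 = b, gram X q 1 1 = c at *
      generalize pd 0 f q = x, pd 1 f q = y at *
      field_simp
      linear_combination -hF2
    · rw [along, fderiv_eq_pd]
      simp
      ring

end IsImmersionOn

/-- Differentiated orthogonality and normalization relations: the source of all skew-symmetries of
the connection coefficients. -/
lemma lorentz_along_of_const {U : Set Plane} (hU : IsOpen U) {q : Plane} (hq : q ∈ U)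
    {u : Plane → Plane} {V W : Plane → R51} {c : ℝ} (hV : SmoothAt U V) (hW : SmoothAt U W)
    (h : ∀ q ∈ U, lorentz (V q) (W q) = c) :
    lorentz (along u V q) (W q) = -lorentz (V q) (along u W q) := by
  have h1 := along_congr (v := u) hU hq h
  rw [along_lorentz (hV.diff hq) (hW.diff hq), along_const] at h1
  linarith

/-- A smooth orthonormal frame `v, w` of an immersed surface with `v` in the direction of
the gradient of a positive function `f`. -/
structure IsGradientFrame (U : Set Plane) (X : Plane → R51) (f : Plane → ℝ)
    (v w : Plane → Plane) : Prop extends IsImmersionOn U X where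
  smooth_f : SmoothAt U f
  smooth_v : SmoothAt U v
  smooth_w : SmoothAt U w
  orthonormal : ∀ q ∈ U, OrthonormalAt X q (v q) (w q)
  f_pos : ∀ q ∈ U, 0 < f q
  along_v_pos : ∀ q ∈ U, 0 < along v f q
  along_w_eq : ∀ q ∈ U, along w f q = 0

/-! ### Connection coefficients and bracket of a gradient frame. -/

namespace IsGradientFrame

variable {U : Set Plane} {X : Plane → R51} {f : Plane → ℝ} {v w : Plane → Plane} {q : Plane}
variable (h : IsGradientFrame U X f v w)

include h

lemma smooth_E₁ : SmoothAt U (along v X) := h.smooth.along h.smooth_v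
lemma smooth_E₂ : SmoothAt U (along w X) := h.smooth.along h.smooth_w

lemma E₁_E₁ (hq : q ∈ U) : lorentz (along v X q) (along v X q) = 1 := (h.orthonormal q hq).left
lemma E₂_E₂ (hq : q ∈ U) : lorentz (along w X q) (along w X q) = 1 := (h.orthonormal q hq).right
lemma E₁_E₂ (hq : q ∈ U) : lorentz (along v X q) (along w X q) = 0 := (h.orthonormal q hq).cross
lemma X_X (hq : q ∈ U) : lorentz (X q) (X q) = -1 := (h.mem_H4 q hq).1
lemma E₁_X (hq : q ∈ U) : lorentz (along v X q) (X q) = 0 := h.lorentz_fderiv_self hq _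
lemma E₂_X (hq : q ∈ U) : lorentz (along w X q) (X q) = 0 := h.lorentz_fderiv_self hq _

lemma along_E₁_E₁ (hq : q ∈ U) (u : Plane → Plane) :
    lorentz (along u (along v X) q) (along v X q) = 0 := by
  have := lorentz_along_of_const (u := u) h.isOpen hq h.smooth_E₁ h.smooth_E₁ fun q hq => h.E₁_E₁ hq
  rw [lorentz_comm (along v X q)] at this
  linarith

lemma along_E₂_E₂ (hq : q ∈ U) (u : Plane → Plane) :
    lorentz (along u (along w X) q) (along w X q) = 0 := by
  have := lorentz_along_of_const (u := u) h.isOpen hq h.smooth_E₂ h.smooth_E₂ fun q hq => h.E₂_E₂ hq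
  rw [lorentz_comm (along w X q)] at this
  linarith

lemma along_E₂_E₁ (hq : q ∈ U) (u : Plane → Plane) :
    lorentz (along u (along w X) q) (along v X q)
      = -lorentz (along u (along v X) q) (along w X q) := by
  rw [lorentz_along_of_const (u := u) h.isOpen hq h.smooth_E₂ h.smooth_E₁ (c := 0)
    fun q hq => by rw [lorentz_comm, h.E₁_E₂ hq], lorentz_comm]

lemma along_E₁_X (hq : q ∈ U) (u : Plane → Plane) :
    lorentz (along u (along v X) q) (X q) = -lorentz (along v X q) (along u X q) :=
  lorentz_along_of_const (u := u) h.isOpen hq h.smooth_E₁ h.smooth fun _ hq => h.E₁_X hq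

lemma along_E₂_X (hq : q ∈ U) (u : Plane → Plane) :
    lorentz (along u (along w X) q) (X q) = -lorentz (along w X q) (along u X q) :=
  lorentz_along_of_const (u := u) h.isOpen hq h.smooth_E₂ h.smooth fun _ hq => h.E₂_X hq

/-- The bracket of the frame, expressed by the connection coefficients. -/
lemma lieBracket_eq (hq : q ∈ U) : VectorField.lieBracket ℝ v w q =
    (-lorentz (along v (along v X) q) (along w X q)) • v q
      + lorentz (along w (along w X) q) (along v X q) • w q := by
  have h1 := along_comm (h.smooth q hq) (h.smooth_v.diff hq) (h.smooth_w.diff hq)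
  rw [(h.orthonormal q hq).eq_frame (VectorField.lieBracket ℝ v w q), ← h1]
  change lorentz _ (along v X q) • v q + lorentz _ (along w X q) • w q = _
  rw [lorentz_sub_left, lorentz_sub_left, h.along_E₂_E₁ hq v, h.along_E₁_E₁ hq,
    h.along_E₂_E₂ hq, h.along_E₂_E₁ hq w]
  module

lemma along_comm_eq {F : Type*} [NormedAddCommGroup F] [NormedSpace ℝ F] {V : Plane → F}
    (hV : SmoothAt U V) (hq : q ∈ U) :
    along v (along w V) q - along w (along v V) q =
      (-lorentz (along v (along v X) q) (along w X q)) • along v V q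
      + lorentz (along w (along w X) q) (along v X q) • along w V q := by
  rw [along_comm (hV q hq) (h.smooth_v.diff hq) (h.smooth_w.diff hq), h.lieBracket_eq hq,
    map_add, map_smul, map_smul]
  rfl

end IsGradientFrame

/-! ### From the bitension field to an equation in the frame. -/

section FromInvariants

variable {U : Set Plane} {X : Plane → R51} {q : Plane}

lemma pd_gram (h : IsImmersionOn U X) (hq : q ∈ U) (i j k : Fin 2) :
    pd i (fun x => gram X x j k) q
      = lorentz (pd i (pd j X) q) (pd k X q) + lorentz (pd i (pd k X) q) (pd j X q) := by
  have := along_lorentz (v := fun _ => EuclideanSpace.single i 1)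
    ((h.smooth.pd j).diff hq) ((h.smooth.pd k).diff hq)
  rw [lorentz_comm (pd i (pd k X) q)]
  exact this

lemma pd_pd_comm (h : IsImmersionOn U X) (hq : q ∈ U) (i j : Fin 2) :
    pd i (pd j X) q = pd j (pd i X) q := by
  rw [pd_pd_eq (h.smooth q hq), pd_pd_eq (h.smooth q hq)]
  exact (h.smooth q hq).isSymmSndFDerivAt
    (by simpa using (WithTop.coe_le_coe.2 le_top : ((2 : ℕ∞) : ℕ∞ω) ≤ ∞)) _ _

/-- Substituting the derivatives of the metric into the Koszul formula leaves `⟨∂ᵢ∂ⱼX, ∂ₗX⟩`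
contracted with the inverse metric: the coordinates of the tangential part of `∂ᵢ∂ⱼX`. -/
lemma OrthonormalAt.christoffel_eq {v w : Plane} (ho : OrthonormalAt X q v w)
    (h : IsImmersionOn U X) (hq : q ∈ U) (k i j : Fin 2) :
    christoffel X k i j q = lorentz (pd i (pd j X) q) (fderiv ℝ X q v) * v k
      + lorentz (pd i (pd j X) q) (fderiv ℝ X q w) * w k := by
  simp only [christoffel, pd_gram h hq, ho.gInv_eq, Fin.sum_univ_two, fderiv_eq_pd X q,
    lorentz_add_right, lorentz_smul_right]
  rw [pd_pd_comm h hq j i, pd_pd_comm h hq 0 i, pd_pd_comm h hq 1 i, pd_pd_comm h hq 0 j,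
    pd_pd_comm h hq 1 j]
  ring

variable {f : Plane → ℝ} {v w : Plane → Plane}

/-- The tangential part of the rough Laplacian of a normal field, in a frame. -/
lemma IsGradientFrame.roughLaplacian_tangent (h : IsGradientFrame U X f v w) (hq : q ∈ U)
    {V : Plane → R51} (hV : SmoothAt U V) (hX : ∀ q ∈ U, lorentz (V q) (X q) = 0)
    (hT : ∀ q ∈ U, ∀ u, lorentz (V q) (fderiv ℝ X q u) = 0)
    {E : R51} (hE : lorentz (X q) E = 0) :
    lorentz (roughLaplacian X V q) E = -lorentz
      (along v (along v V) q + along w (along w V) q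
        - lorentz (along v (along v X) q) (along w X q) • along w V q
        - lorentz (along w (along w X) q) (along v X q) • along v V q) E := by
  have ho := h.orthonormal q hq
  -- Since `V` is orthogonal to `X` and to the surface, `⟨∂ⱼV, X⟩ = -⟨V, ∂ⱼX⟩ = 0`, so no projection
  -- is needed for first derivatives.
  have hpull : ∀ j, ∀ x ∈ U, pullConn X j V x = pd j V x := by
    intro j x hx
    have := lorentz_along_of_const (u := fun _ => EuclideanSpace.single j 1) h.isOpen hx hV
      h.smooth hX
    have e : lorentz (pd j V x) (X x) = 0 := by
      refine this.trans ?_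
      rw [along, hT x hx, neg_zero]
    rw [pullConn, hypProj, e, zero_smul, add_zero]
  have hpp : ∀ i j, lorentz (pullConn X i (pullConn X j V) q) E
      = lorentz (pd i (pd j V) q) E := by
    intro i j
    rw [pullConn, lorentz_hypProj_of_orthogonal hE]
    congr 1
    exact along_congr (v := fun _ => EuclideanSpace.single i 1) h.isOpen hq (hpull j)
  -- `L` satisfies `L ∘ dX = dV` and vanishes on normal vectors. The Christoffel term is therefore
  -- `L(D²X)`, and the Hessian of `V` becomes the bilinear form `D²V - L(D²X)`, whose trace can be
  -- taken in the frame.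
  let L : R51 →L[ℝ] R51 := (lorentzL.flip (along v X q)).smulRight (along v V q)
    + (lorentzL.flip (along w X q)).smulRight (along w V q)
  have hL (x : R51) : L x = lorentz x (along v X q) • along v V q
    + lorentz x (along w X q) • along w V q := rfl
  have hLX (u : Plane) : L (fderiv ℝ X q u) = fderiv ℝ V q u := by
    conv_rhs => rw [ho.eq_frame u]
    rw [hL, map_add, map_smul, map_smul]; rfl
  have hΓ : ∀ i j, ∑ k : Fin 2, christoffel X k i j q • pullConn X k V q
      = L (fderiv ℝ (fderiv ℝ X) q (EuclideanSpace.single i 1) (EuclideanSpace.single j 1)) := by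
    intro i j
    simp only [hpull _ q hq]
    rw [← pd_pd_eq (h.smooth q hq), hL, Fin.sum_univ_two, ho.christoffel_eq h.toIsImmersionOn hq,
      ho.christoffel_eq h.toIsImmersionOn hq, along, along, along, along, fderiv_eq_pd V q,
      fderiv_eq_pd V q]
    module
  have hsum := ho.sum_gInv_smul (fderiv ℝ (fderiv ℝ V) q -
    ((ContinuousLinearMap.compL ℝ Plane R51 R51) L).comp (fderiv ℝ (fderiv ℝ X) q))
  have hD (u : Plane → Plane) (hu : SmoothAt U u) :
      fderiv ℝ (fderiv ℝ V) q (u q) (u q) - L (fderiv ℝ (fderiv ℝ X) q (u q) (u q))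
        = along u (along u V) q - L (along u (along u X) q) := by
    rw [along_along (hV q hq) (hu.diff hq), along_along (h.smooth q hq) (hu.diff hq), map_add,
      hLX]
    abel
  simp only [_root_.sub_apply, ContinuousLinearMap.comp_apply,
    ContinuousLinearMap.compL_apply] at hsum
  rw [hD v h.smooth_v, hD w h.smooth_w, hL, hL, h.along_E₁_E₁ hq, h.along_E₂_E₂ hq] at hsum
  have hfin := congrArg (fun y => lorentz y E) hsum
  simp only [lorentz_sum_left, lorentz_smul_left] at hfin
  simp only [roughLaplacian, lorentz_neg_left, lorentz_sum_left, lorentz_smul_left,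
    lorentz_sub_left, hpp, hΓ]
  simp only [pd_pd_eq (hV q hq)]
  simp only [lorentz_sub_left] at hfin
  rw [hfin]
  simp only [lorentz_add_left, lorentz_sub_left, lorentz_smul_left]
  ring

/-- A gradient frame together with a unit normal field `N`, parallel in the normal bundle and
in the direction of the mean curvature vector `f N`, satisfying the biconservative equation. -/
structure IsBiconservativeFrame (U : Set Plane) (X : Plane → R51) (f : Plane → ℝ)
    (v w : Plane → Plane) (N : Plane → R51) : Prop extends IsGradientFrame U X f v w where
  smooth_N : SmoothAt U N
  N_N : ∀ q ∈ U, lorentz (N q) (N q) = 1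
  N_X : ∀ q ∈ U, lorentz (N q) (X q) = 0
  N_E₁ : ∀ q ∈ U, lorentz (N q) (along v X q) = 0
  N_E₂ : ∀ q ∈ U, lorentz (N q) (along w X q) = 0
  along_N : ∀ q ∈ U, ∀ u : Plane → Plane,
    along u N q = lorentz (along u N q) (along v X q) • along v X q
    + lorentz (along u N q) (along w X q) • along w X q
  trace : ∀ q ∈ U, along v (along v X) q + along w (along w X) q =
    (2 * f q) • N q + (2 : ℝ) • X q
      + lorentz (along v (along v X) q) (along w X q) • along w X q
      + lorentz (along w (along w X) q) (along v X q) • along v X q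
  bicons : ∀ q ∈ U, ∀ u : Plane, lorentz
      (along v (along v fun x => (2 * f x) • N x) q + along w (along w fun x => (2 * f x) • N x) q
        - lorentz (along v (along v X) q) (along w X q) • along w (fun x => (2 * f x) • N x) q
        - lorentz (along w (along w X) q) (along v X q) • along v (fun x => (2 * f x) • N x) q)
      (fderiv ℝ X q u) = 0

lemma OrthonormalAt.lorentz_normPart_tangent {v w : Plane} (ho : OrthonormalAt X q v w)
    (h : ∀ u, lorentz (fderiv ℝ X q u) (X q) = 0) (x : R51) (u : Plane) :
    lorentz (normPart X q x) (fderiv ℝ X q u) = 0 := by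
  have hc := ho.cross
  rw [ho.eq_frame u, map_add, map_smul, map_smul, normPart, ho.tangPart_eq]
  simp only [hypProj, lorentz_add_left, lorentz_sub_left, lorentz_smul_left, lorentz_add_right,
    lorentz_smul_right, ho.left, ho.right, hc, lorentz_comm (X q), h,
    lorentz_comm (fderiv ℝ X q w) (fderiv ℝ X q v)]
  ring

lemma OrthonormalAt.lorentz_normPart_self {v w : Plane} (ho : OrthonormalAt X q v w)
    (h : ∀ u, lorentz (fderiv ℝ X q u) (X q) = 0) (hX : lorentz (X q) (X q) = -1) (x : R51) :
    lorentz (normPart X q x) (X q) = 0 := by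
  rw [normPart, ho.tangPart_eq]
  simp only [hypProj, lorentz_add_left, lorentz_sub_left, lorentz_smul_left, h, hX]
  ring

/-- Differentiating the field `u` itself only adds a tangent vector. -/
lemma IsGradientFrame.normPart_along_along (h : IsGradientFrame U X f v w) (hq : q ∈ U)
    {u : Plane → Plane} (hu : SmoothAt U u) :
    normPart X q (fderiv ℝ (fderiv ℝ X) q (u q) (u q))
      = normPart X q (along u (along u X) q) := by
  rw [along_along (h.smooth q hq) (hu.diff hq), normPart_add,
    (h.orthonormal q hq).normPart_fderiv (fun u => h.lorentz_fderiv_self hq u), add_zero]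

/-- Parallelism of the unit normal means that its derivatives are tangent to the surface. As the
tension field is normal, the curvature term in the bitension field is a multiple of it, so only the
rough Laplacian contributes to the tangential part. -/
lemma IsGradientFrame.isBiconservativeFrame (h : IsGradientFrame U X (meanCurv X) v w)
    (hpar : ∀ q ∈ U, ∀ i : Fin 2,
      normalConn X i (fun x => (meanCurv X x)⁻¹ • meanCurvVec X x) q = 0)
    (hbi : ∀ q ∈ U, tangPart X q (bitension X q) = 0) :
    IsBiconservativeFrame U X (meanCurv X) v w
      fun x => (meanCurv X x)⁻¹ • meanCurvVec X x := by
  have hH : ∀ q ∈ U, meanCurvVec X q = (1 / 2 : ℝ) • (normPart X q (along v (along v X) q)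
      + normPart X q (along w (along w X) q)) := by
    intro q hq
    rw [(h.orthonormal q hq).meanCurvVec_eq (h.smooth q hq),
      h.normPart_along_along hq h.smooth_v, h.normPart_along_along hq h.smooth_w]
  have hHT : ∀ q ∈ U, ∀ u, lorentz (meanCurvVec X q) (fderiv ℝ X q u) = 0 := by
    intro q hq u
    rw [hH q hq, lorentz_smul_left, lorentz_add_left,
      (h.orthonormal q hq).lorentz_normPart_tangent (h.lorentz_fderiv_self hq),
      (h.orthonormal q hq).lorentz_normPart_tangent (h.lorentz_fderiv_self hq)]
    simp
  have hHX : ∀ q ∈ U, lorentz (meanCurvVec X q) (X q) = 0 := by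
    intro q hq
    rw [hH q hq, lorentz_smul_left, lorentz_add_left,
      (h.orthonormal q hq).lorentz_normPart_self (h.lorentz_fderiv_self hq) (h.X_X hq),
      (h.orthonormal q hq).lorentz_normPart_self (h.lorentz_fderiv_self hq) (h.X_X hq)]
    simp
  have hsN : SmoothAt U fun x => (meanCurv X x)⁻¹ • meanCurvVec X x :=
    (h.smooth_f.inv fun q hq => (h.f_pos q hq).ne').smul h.smooth_meanCurvVec
  have hNX : ∀ q ∈ U, lorentz ((meanCurv X q)⁻¹ • meanCurvVec X q) (X q) = 0 := fun q hq => by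
    rw [lorentz_smul_left, hHX q hq, mul_zero]
  have hNT : ∀ q ∈ U, ∀ u, lorentz ((meanCurv X q)⁻¹ • meanCurvVec X q) (fderiv ℝ X q u) = 0 :=
    fun q hq u => by rw [lorentz_smul_left, hHT q hq, mul_zero]
  have hHN : ∀ q ∈ U, meanCurvVec X q
      = meanCurv X q • ((meanCurv X q)⁻¹ • meanCurvVec X q) := fun q hq => by
    rw [smul_smul, mul_inv_cancel₀ (h.f_pos q hq).ne', one_smul]
  have hten : ∀ q ∈ U, tension X q
      = (2 * meanCurv X q) • ((meanCurv X q)⁻¹ • meanCurvVec X q) := fun q hq => by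
    rw [mul_smul, ← hHN q hq, tension]
  refine ⟨h, hsN, ?_, hNX, fun q hq => hNT q hq _, fun q hq => hNT q hq _, ?_, ?_, ?_⟩
  · intro q hq
    have hp : 0 < lorentz (meanCurvVec X q) (meanCurvVec X q) := Real.sqrt_pos.1 (h.f_pos q hq)
    have hf2 : meanCurv X q ^ 2 = lorentz (meanCurvVec X q) (meanCurvVec X q) :=
      Real.sq_sqrt hp.le
    have h0 := (h.f_pos q hq).ne'
    rw [lorentz_smul_left, lorentz_smul_right, ← hf2]
    field_simp
  · intro q hq u
    have h1 : normPart X q (along u (fun x => (meanCurv X x)⁻¹ • meanCurvVec X x) q) = 0 := by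
      rw [along, fderiv_eq_pd, normPart_add, normPart_smul, normPart_smul]
      have e0 := hpar q hq 0
      have e1 := hpar q hq 1
      rw [normalConn] at e0 e1
      rw [e0, e1]; simp
    have h2 : lorentz (along u (fun x => (meanCurv X x)⁻¹ • meanCurvVec X x) q) (X q) = 0 := by
      rw [lorentz_along_of_const h.isOpen hq hsN h.smooth hNX, along, hNT q hq, neg_zero]
    rw [normPart, hypProj, h2, zero_smul, add_zero, sub_eq_zero,
      (h.orthonormal q hq).tangPart_eq] at h1
    exact h1
  · intro q hq
    have h1 := hH q hq
    rw [hHN q hq, normPart, normPart, (h.orthonormal q hq).tangPart_eq,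
      (h.orthonormal q hq).tangPart_eq] at h1
    have h2 := congrArg (fun y => (2 : ℝ) • y) h1
    simp only [smul_smul, ← mul_assoc] at h2 ⊢
    have e1 := h.along_E₁_X hq v
    have e2 := h.along_E₂_X hq w
    rw [h.E₁_E₁ hq] at e1
    rw [h.E₂_E₂ hq] at e2
    have e3 := h.along_E₁_E₁ hq v
    have e4 := h.along_E₂_E₂ hq w
    unfold along at e1 e2 e3 e4 h2 ⊢
    rw [h2, hypProj, hypProj, e1, e2, e3, e4]
    module
  · intro q hq u
    have hX' : lorentz (X q) (fderiv ℝ X q u) = 0 := by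
      rw [lorentz_comm, h.lorentz_fderiv_self hq]
    have hsT : SmoothAt U (tension X) := SmoothAt.smul (.const _) h.smooth_meanCurvVec
    have hTX : ∀ q ∈ U, lorentz (tension X q) (X q) = 0 := fun q hq => by
      rw [tension, lorentz_smul_left, hHX q hq, mul_zero]
    have hTT : ∀ q ∈ U, ∀ u, lorentz (tension X q) (fderiv ℝ X q u) = 0 := fun q hq u => by
      rw [tension, lorentz_smul_left, hHT q hq, mul_zero]
    have hbt : lorentz (bitension X q) (fderiv ℝ X q u) = 0 := by
      have h1 := hbi q hq
      have ho := h.orthonormal q hq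
      rw [ho.tangPart_eq] at h1
      have h2 := congrArg (fun y => lorentz y (fderiv ℝ X q (v q))) h1
      have h3 := congrArg (fun y => lorentz y (fderiv ℝ X q (w q))) h1
      have hc := ho.cross
      simp only [lorentz_add_left, lorentz_smul_left, ho.left, ho.right, hc, lorentz_zero_left,
        lorentz_comm (fderiv ℝ X q (w q)) (fderiv ℝ X q (v q))] at h2 h3
      rw [ho.eq_frame u, map_add, map_smul, map_smul, lorentz_add_right, lorentz_smul_right,
        lorentz_smul_right]
      linear_combination lorentz (fderiv ℝ X q u) (fderiv ℝ X q (v q)) * h2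
        + lorentz (fderiv ℝ X q u) (fderiv ℝ X q (w q)) * h3
    -- Constant curvature: `R(∂ᵢ, τ)∂ⱼ` reduces to `⟨∂ᵢ, ∂ⱼ⟩ τ`, which is normal.
    have hcurv : lorentz (∑ i : Fin 2, ∑ j : Fin 2,
        gInv X q i j • hypCurv (pd i X q) (tension X q) (pd j X q)) (fderiv ℝ X q u) = 0 := by
      simp only [lorentz_sum_left, lorentz_smul_left, hypCurv, lorentz_neg_left,
        lorentz_sub_left, hTT q hq u]
      have : ∀ j, lorentz (tension X q) (pd j X q) = 0 := fun j => hTT q hq _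
      simp [this]
    rw [bitension, lorentz_sub_left, hcurv, lorentz_neg_left,
      h.roughLaplacian_tangent hq hsT hTX hTT hX', neg_neg, sub_zero] at hbt
    have hc (y : Plane → Plane) : ∀ x ∈ U, along y (tension X) x = along y (fun x =>
        (2 * meanCurv X x) • ((meanCurv X x)⁻¹ • meanCurvVec X x)) x := fun x hx =>
      along_congr h.isOpen hx hten
    rw [hc v q hq, hc w q hq, along_congr h.isOpen hq (hc v), along_congr h.isOpen hq (hc w)]
      at hbt
    exact hbt

end FromInvariants

/-! ### Shape operator and connection forced by the biconservative equation. -/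

namespace IsBiconservativeFrame

variable {U : Set Plane} {X : Plane → R51} {f : Plane → ℝ} {v w : Plane → Plane}
  {N : Plane → R51} {q : Plane} (h : IsBiconservativeFrame U X f v w N)

include h

/-- Symmetry of the shape operator: the commutator of `D_v`, `D_w` on `X` is tangent, hence
orthogonal to `N`. -/
lemma E₂_along_N (hq : q ∈ U) :
    lorentz (along v N q) (along w X q) = lorentz (along w N q) (along v X q) := by
  have h1 := lorentz_along_of_const (u := v) h.isOpen hq h.smooth_N h.smooth_E₂ h.N_E₂
  have h2 := lorentz_along_of_const (u := w) h.isOpen hq h.smooth_N h.smooth_E₁ h.N_E₁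
  have h3 := congrArg (lorentz (N q)) (h.along_comm_eq h.smooth hq)
  rw [lorentz_sub_right, lorentz_add_right, lorentz_smul_right, lorentz_smul_right,
    h.N_E₁ q hq, h.N_E₂ q hq] at h3
  linarith

lemma trace_shape (hq : q ∈ U) :
    lorentz (along v N q) (along v X q) + lorentz (along w N q) (along w X q) = -(2 * f q) := by
  have h1 := lorentz_along_of_const (u := v) h.isOpen hq h.smooth_N h.smooth_E₁ h.N_E₁
  have h2 := lorentz_along_of_const (u := w) h.isOpen hq h.smooth_N h.smooth_E₂ h.N_E₂
  have h3 := congrArg (lorentz (N q)) (h.trace q hq)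
  simp only [lorentz_add_right, lorentz_smul_right, h.N_N q hq, h.N_X q hq, h.N_E₁ q hq,
    h.N_E₂ q hq] at h3
  linarith

/-- The shape operator of `N` has eigenvalues `-f` and `3f`. -/
lemma shape (hq : q ∈ U) :
    along v N q = f q • along v X q ∧ along w N q = -(3 * f q) • along w X q := by
  have sDv := h.smooth_N.along h.smooth_v
  have sDw := h.smooth_N.along h.smooth_w
  have sE1 := h.smooth_E₁
  have sE2 := h.smooth_E₂
  have sα : SmoothAt U fun q => lorentz (along v N q) (along v X q) := sDv.lorentz sE1
  have sβ : SmoothAt U fun q => lorentz (along w N q) (along v X q) := sDw.lorentz sE1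
  have sγ : SmoothAt U fun q => lorentz (along w N q) (along w X q) := sDw.lorentz sE2
  -- derivatives of the coefficients
  have dα (u : Plane → Plane) := along_lorentz (v := u) (sDv.diff hq) (sE1.diff hq)
  have dβ (u : Plane → Plane) := along_lorentz (v := u) (sDw.diff hq) (sE1.diff hq)
  have dβ' (u : Plane → Plane) := along_lorentz (v := u) (sDv.diff hq) (sE2.diff hq)
  have dγ (u : Plane → Plane) := along_lorentz (v := u) (sDw.diff hq) (sE2.diff hq)
  have hββ (u : Plane → Plane) := along_congr (v := u) h.isOpen hq fun q hq => h.E₂_along_N hq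
  have htr (u : Plane → Plane) := along_congr (v := u) h.isOpen hq fun q hq => h.trace_shape hq
  -- The tangential components of this commutator are the Codazzi equations for the parallel normal
  -- `N`.
  have hcod := h.along_comm_eq h.smooth_N hq
  have hcod1 := congrArg (fun y => lorentz y (along v X q)) hcod
  have hcod2 := congrArg (fun y => lorentz y (along w X q)) hcod
  have hb1 := h.bicons q hq (v q)
  have hb2 := h.bicons q hq (w q)
  have sf2 : SmoothAt U fun q => 2 * f q := (SmoothAt.const 2).mul h.smooth_f
  have d2f (u : Plane → Plane) : ∀ x ∈ U, along u (fun q => 2 * f q) x = 2 * along u f x :=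
    fun x hx => by
      rw [along_mul ((SmoothAt.const (U := U) (2 : ℝ)).diff hx) (h.smooth_f.diff hx), along_const]
      ring
  have sdf : SmoothAt U fun q => 2 * along v f q :=
    (SmoothAt.const 2).mul (h.smooth_f.along h.smooth_v)
  have hVv : ∀ x ∈ U, along v (fun x => (2 * f x) • N x) x
      = (2 * along v f x) • N x + (2 * f x) • along v N x := fun x hx => by
    rw [along_smul (sf2.diff hx) (h.smooth_N.diff hx), d2f v x hx]
  have hVw : ∀ x ∈ U, along w (fun x => (2 * f x) • N x) x = (2 * f x) • along w N x :=
    fun x hx => by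
      rw [along_smul (sf2.diff hx) (h.smooth_N.diff hx), d2f w x hx, h.along_w_eq x hx]
      simp
  rw [along_congr h.isOpen hq hVv, along_congr h.isOpen hq hVw, hVv q hq, hVw q hq,
    along_add ((sdf.smul h.smooth_N).diff hq) ((sf2.smul sDv).diff hq),
    along_smul (sdf.diff hq) (h.smooth_N.diff hq), along_smul (sf2.diff hq) (sDv.diff hq),
    along_smul (sf2.diff hq) (sDw.diff hq), d2f v q hq, d2f w q hq, h.along_w_eq q hq] at hb1 hb2
  change lorentz _ (along v X q) = 0 at hb1
  change lorentz _ (along w X q) = 0 at hb2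
  have htr' := h.trace_shape hq
  have hβ' := h.E₂_along_N hq
  have tv := htr v
  have tw := htr w
  rw [along_add (sα.diff hq) (sγ.diff hq), along_neg, d2f v q hq] at tv
  rw [along_add (sα.diff hq) (sγ.diff hq), along_neg, d2f w q hq, h.along_w_eq q hq] at tw
  have expand (y : R51) : lorentz (along v N q) y = lorentz (along v N q) (along v X q) *
        lorentz (along v X q) y + lorentz (along v N q) (along w X q) * lorentz (along w X q) y := by
    conv_lhs => rw [h.along_N q hq v, lorentz_add_left, lorentz_smul_left, lorentz_smul_left]
  have expand' (y : R51) : lorentz (along w N q) y = lorentz (along w N q) (along v X q) *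
        lorentz (along v X q) y + lorentz (along w N q) (along w X q) * lorentz (along w X q) y := by
    conv_lhs => rw [h.along_N q hq w, lorentz_add_left, lorentz_smul_left, lorentz_smul_left]
  have dαv := dα v
  have dαw := dα w
  have dβv := dβ v
  have dβw := dβ w
  have dβv' := (hββ v).symm.trans (dβ' v)
  have dβw' := (hββ w).symm.trans (dβ' w)
  have dγv := dγ v
  have dγw := dγ w
  rw [expand] at dαv dαw dβv' dβw'
  rw [expand'] at dβv dβw dγv dγw
  have o1 (u) := h.along_E₁_E₁ hq u
  have o2 (u) := h.along_E₂_E₂ hq u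
  have o3 (u) := h.along_E₂_E₁ hq u
  rw [hβ'] at dαv dαw dβv' dβw'
  simp only [lorentz_add_left, lorentz_sub_left, lorentz_smul_left, h.N_E₁ q hq, h.N_E₂ q hq]
    at hcod1 hcod2 hb1 hb2
  have c1 := fun y => lorentz_comm (along v X q) y
  have c2 := fun y => lorentz_comm (along w X q) y
  rw [c1, c2, o1] at dαv dαw dβv dβw
  rw [c1, c2, o2, o3] at dβv' dβw' dγv dγw
  have o3w := o3 w
  have eF : along v f q ≠ 0 := (h.along_v_pos q hq).ne'
  rw [hβ'] at hcod2 hb2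
  -- Codazzi and the derivative of the trace `-2f` eliminate all derivatives of the shape operator.
  -- What remains of the two biconservative components is `v(f)(α - f) = 0` and `v(f) β = 0`, with
  -- `α = ⟨D_v N, E₁⟩` and `β = ⟨D_w N, E₁⟩`.
  have hα : lorentz (along v N q) (along v X q) = f q := by
    have : (4 * along v f q) * (lorentz (along v N q) (along v X q) - f q) = 0 := by
      linear_combination hb1 - 2 * f q * (-dαv - dβw + dβw' - hcod2 - dγv + tv
        - (lorentz (along v N q) (along v X q) + lorentz (along w N q) (along w X q)) * o3w)
    rcases mul_eq_zero.1 this with h1 | h1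
    · exact absurd h1 (by positivity)
    · linarith
  have hβ : lorentz (along w N q) (along v X q) = 0 := by
    have : (4 * along v f q) * lorentz (along w N q) (along v X q) = 0 := by
      linear_combination hb2 - 2 * f q * (-dβv' - dγw + dβv + hcod1 - dαw + tw)
    exact (mul_eq_zero.1 this).resolve_left (by positivity)
  have hγ : lorentz (along w N q) (along w X q) = -(3 * f q) := by linarith
  constructor
  · rw [h.along_N q hq v, hα, hβ', hβ]; simp
  · rw [h.along_N q hq w, hβ, hγ]; simp

/-- The connection coefficient `⟨∇_w w, v⟩` of the frame. -/
lemma connection (hq : q ∈ U) :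
    lorentz (along v (along v X) q) (along w X q) = 0 ∧
    lorentz (along w (along w X) q) (along v X q) = 3 * along v f q / (4 * f q) ∧
    along v (along w X) q = 0 ∧
    along w (along v X) q = -(3 * along v f q / (4 * f q)) • along w X q := by
  have hf := h.f_pos q hq
  have h1 := h.along_comm_eq h.smooth_N hq
  have hX := h.along_comm_eq h.smooth hq
  have sf3 : SmoothAt U fun q => -(3 * f q) := ((SmoothAt.const 3).mul h.smooth_f).neg
  rw [along_congr h.isOpen hq fun q hq => (h.shape hq).2,
    along_congr h.isOpen hq fun q hq => (h.shape hq).1, (h.shape hq).1, (h.shape hq).2,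
    along_smul (sf3.diff hq) (h.smooth_E₂.diff hq),
    along_smul (h.smooth_f.diff hq) (h.smooth_E₁.diff hq), h.along_w_eq q hq,
    along_neg, along_mul ((SmoothAt.const (U := U) (3 : ℝ)).diff hq) (h.smooth_f.diff hq),
    along_const] at h1
  have hP := h.along_E₂_E₁ hq v
  have hP2 := h.along_E₂_E₂ hq v
  generalize lorentz (along v (along v X) q) (along w X q) = a at *
  generalize lorentz (along w (along w X) q) (along v X q) = b at *
  have hw : along w (along v X) q = along v (along w X) q + a • along v X q
      - b • along w X q := by
    rw [sub_eq_iff_eq_add] at hX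
    rw [hX]; module
  -- The commutator on `N`, with `D_w E₁` eliminated through the commutator on `X`. It is an
  -- identity of full vectors, so it contains Codazzi and also Ricci: `D_v E₂` has no normal
  -- component. The factor `4f` is the difference of the eigenvalues `3f` and `-f`.
  have key : (4 * f q) • along v (along w X) q
      = (4 * f q * b - 3 * along v f q) • along w X q := by
    rw [hw] at h1
    linear_combination (norm := module) -h1
  have ha : a = 0 := by
    have := congrArg (fun y => lorentz y (along v X q)) key
    simp only [lorentz_smul_left, hP, lorentz_comm (along w X q), h.E₁_E₂ hq] at this
    rcases mul_eq_zero.1 (by linarith : (4 * f q) * a = 0) with h | h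
    · linarith
    · exact h
  have hb : b = 3 * along v f q / (4 * f q) := by
    have := congrArg (fun y => lorentz y (along w X q)) key
    simp only [lorentz_smul_left, hP2, h.E₂_E₂ hq] at this
    field_simp
    linarith
  have h0 : along v (along w X) q = 0 := by
    have e : 4 * f q * b - 3 * along v f q = 0 := by rw [hb]; field_simp; ring
    rw [e, zero_smul] at key
    exact (smul_eq_zero.1 key).resolve_left (by positivity)
  refine ⟨ha, hb, h0, ?_⟩
  rw [hw, h0, ha, ← hb]; module

end IsBiconservativeFrame

/-- The structure equations of a frame on a PNMC biconservative surface: `b` is the connection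
coefficient of the frame and `N` the unit normal in the direction of the mean curvature. -/
structure IsPNMCFrame (U : Set Plane) (X : Plane → R51) (f b : Plane → ℝ)
    (v w : Plane → Plane) (N : Plane → R51) : Prop extends IsGradientFrame U X f v w where
  smooth_N : SmoothAt U N
  N_N : ∀ q ∈ U, lorentz (N q) (N q) = 1
  N_X : ∀ q ∈ U, lorentz (N q) (X q) = 0
  N_E₁ : ∀ q ∈ U, lorentz (N q) (along v X q) = 0
  N_E₂ : ∀ q ∈ U, lorentz (N q) (along w X q) = 0
  smooth_b : SmoothAt U b
  along_f : ∀ q ∈ U, along v f q = 4 / 3 * f q * b q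
  v_N : ∀ q ∈ U, along v N q = f q • along v X q
  w_N : ∀ q ∈ U, along w N q = -(3 * f q) • along w X q
  w_E₂ : ∀ q ∈ U, along w (along w X) q =
    (2 * f q) • N q + (2 : ℝ) • X q + b q • along v X q - along v (along v X) q
  w_E₁ : ∀ q ∈ U, along w (along v X) q = -b q • along w X q
  v_E₂ : ∀ q ∈ U, along v (along w X) q = 0
  lieBracket : ∀ q ∈ U, VectorField.lieBracket ℝ v w q = b q • w q

lemma IsBiconservativeFrame.isPNMCFrame {U : Set Plane} {X : Plane → R51} {f : Plane → ℝ}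
    {v w : Plane → Plane} {N : Plane → R51} (h : IsBiconservativeFrame U X f v w N) :
    IsPNMCFrame U X f (fun q => 3 * along v f q / (4 * f q)) v w N where
  toIsGradientFrame := h.toIsGradientFrame
  smooth_N := h.smooth_N
  N_N := h.N_N
  N_X := h.N_X
  N_E₁ := h.N_E₁
  N_E₂ := h.N_E₂
  smooth_b := by
    simp only [div_eq_mul_inv]
    exact ((SmoothAt.const 3).mul (h.smooth_f.along h.smooth_v)).mul
      (((SmoothAt.const 4).mul h.smooth_f).inv fun q hq => by have := h.f_pos q hq; positivity)
  along_f q hq := by have := h.f_pos q hq; field_simp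
  v_N q hq := (h.shape hq).1
  w_N q hq := (h.shape hq).2
  w_E₂ q hq := by
    have h1 := h.trace q hq
    rw [(h.connection hq).1, (h.connection hq).2.1, zero_smul, add_zero] at h1
    rw [← h1]; abel
  w_E₁ q hq := (h.connection hq).2.2.2
  v_E₂ q hq := (h.connection hq).2.2.1
  lieBracket q hq := by
    rw [h.lieBracket_eq hq, (h.connection hq).1, (h.connection hq).2.1]
    module

/-! ### Constancy of functions with vanishing frame derivatives. -/

namespace IsGradientFrame

variable {U : Set Plane} {X : Plane → R51} {f : Plane → ℝ} {v w : Plane → Plane} {q : Plane}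
  {F : Type*} [NormedAddCommGroup F] [NormedSpace ℝ F]

lemma fderiv_eq (h : IsGradientFrame U X f v w) (hq : q ∈ U) (V : Plane → F) (u : Plane) :
    fderiv ℝ V q u = lorentz (fderiv ℝ X q u) (along v X q) • along v V q
      + lorentz (fderiv ℝ X q u) (along w X q) • along w V q := by
  conv_lhs => rw [(h.orthonormal q hq).eq_frame u, map_add, map_smul, map_smul]
  rfl

lemma eq_of_along_eq_zero (h : IsGradientFrame U X f v w) (hU : IsPreconnected U) {V : Plane → F}
    (hV : SmoothAt U V) (h1 : ∀ q ∈ U, along v V q = 0) (h2 : ∀ q ∈ U, along w V q = 0)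
    {x y : Plane} (hx : x ∈ U) (hy : y ∈ U) : V x = V y := by
  refine h.isOpen.is_const_of_fderiv_eq_zero (𝕜 := ℝ) hU
    (fun q hq => (hV.diff hq).differentiableWithinAt) (fun q hq => ?_) hx hy
  ext u
  rw [h.fderiv_eq hq, h1 q hq, h2 q hq]
  simp

end IsGradientFrame

/-! ### Structure equations, first integrals and reduction of codimension. -/

namespace IsPNMCFrame

variable {U : Set Plane} {X : Plane → R51} {f b : Plane → ℝ} {v w : Plane → Plane}
  {N : Plane → R51} {q : Plane} (h : IsPNMCFrame U X f b v w N)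

include h

lemma smooth_A : SmoothAt U (along v (along v X)) := h.smooth_E₁.along h.smooth_v
lemma smooth_W : SmoothAt U (along w (along w X)) := h.smooth_E₂.along h.smooth_w

lemma b_pos (hq : q ∈ U) : 0 < b q := by
  have h1 := h.along_v_pos q hq
  have h2 := h.f_pos q hq
  rw [h.along_f q hq] at h1
  exact pos_of_mul_pos_right h1 (by positivity)

lemma along_comm_eq {F : Type*} [NormedAddCommGroup F] [NormedSpace ℝ F] {V : Plane → F}
    (hV : SmoothAt U V) (hq : q ∈ U) :
    along v (along w V) q - along w (along v V) q = b q • along w V q := by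
  rw [along_comm (hV q hq) (h.smooth_v.diff hq) (h.smooth_w.diff hq), h.lieBracket q hq, map_smul]
  rfl

/-- The commutator applied to `f`: since `w f = 0`, also `w(v f) = 0`, and `b` is a multiple of
`v(f)/f`. -/
lemma w_b (hq : q ∈ U) : along w b q = 0 := by
  have h1 := h.along_comm_eq h.smooth_f hq
  have s : SmoothAt U fun q => 4 / 3 * f q := (SmoothAt.const _).mul h.smooth_f
  rw [along_congr h.isOpen hq h.along_w_eq, along_const, h.along_w_eq q hq,
    along_congr h.isOpen hq h.along_f, along_mul (s.diff hq) (h.smooth_b.diff hq),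
    along_mul ((SmoothAt.const (U := U) (4 / 3 : ℝ)).diff hq) (h.smooth_f.diff hq), along_const,
    h.along_w_eq q hq] at h1
  have hf := h.f_pos q hq
  have : (4 / 3 * f q) * along w b q = 0 := by simp at h1; simpa using h1
  exact (mul_eq_zero.1 this).resolve_left (by positivity)

/-- Because `D_v E₂ = 0`, the commutator on `E₂` loses its second term. -/
lemma v_W (hq : q ∈ U) :
    along v (along w (along w X)) q = b q • along w (along w X) q := by
  have h1 := h.along_comm_eq h.smooth_E₂ hq
  rwa [along_congr (v := w) h.isOpen hq h.v_E₂, along_const, sub_zero] at h1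

lemma w_A (hq : q ∈ U) :
    along w (along v (along v X)) q = (b q ^ 2 - along v b q) • along w X q := by
  have h1 := h.along_comm_eq h.smooth_E₁ hq
  rw [along_congr (v := v) h.isOpen hq h.w_E₁, along_smul (h.smooth_b.neg.diff hq)
    (h.smooth_E₂.diff hq), h.v_E₂ q hq, h.w_E₁ q hq, along_neg] at h1
  linear_combination (norm := module) -h1

lemma A_E₂ (hq : q ∈ U) : lorentz (along v (along v X) q) (along w X q) = 0 := by
  have := h.along_E₂_E₁ hq v
  rw [h.v_E₂ q hq, lorentz_zero_left] at this
  linarith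

lemma A_N (hq : q ∈ U) : lorentz (along v (along v X) q) (N q) = -f q := by
  rw [lorentz_along_of_const h.isOpen hq h.smooth_E₁ h.smooth_N (c := 0)
    fun q hq => by rw [lorentz_comm, h.N_E₁ q hq], h.v_N q hq, lorentz_smul_right, h.E₁_E₁ hq,
    mul_one]

lemma A_X (hq : q ∈ U) : lorentz (along v (along v X) q) (X q) = -1 := by
  rw [h.along_E₁_X hq, h.E₁_E₁ hq]

lemma W_E₁ (hq : q ∈ U) : lorentz (along w (along w X) q) (along v X q) = b q := by
  rw [h.along_E₂_E₁ hq, h.w_E₁ q hq, lorentz_smul_left, h.E₂_E₂ hq]; ring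

lemma W_X (hq : q ∈ U) : lorentz (along w (along w X) q) (X q) = -1 := by
  rw [h.along_E₂_X hq, h.E₂_E₂ hq]

omit h in
/-- The component of the second fundamental form orthogonal to the mean curvature. -/
def normalComponent (X : Plane → R51) (f : Plane → ℝ) (v : Plane → Plane) (N : Plane → R51)
    (q : Plane) : R51 := along v (along v X) q + f q • N q - X q

lemma smooth_normalComponent : SmoothAt U (normalComponent X f v N) :=
  (h.smooth_A.add (h.smooth_f.smul h.smooth_N)).sub h.smooth

lemma normalComponent_X (hq : q ∈ U) : lorentz (normalComponent X f v N q) (X q) = 0 := by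
  simp only [normalComponent, lorentz_add_left, lorentz_sub_left, lorentz_smul_left, h.A_X hq,
    h.N_X q hq, h.X_X hq]
  ring

lemma normalComponent_self_nonneg (hq : q ∈ U) :
    0 ≤ lorentz (normalComponent X f v N q) (normalComponent X f v N q) :=
  lorentz_self_nonneg (h.mem_H4 q hq) (h.normalComponent_X hq)

lemma normalComponent_N (hq : q ∈ U) : lorentz (normalComponent X f v N q) (N q) = 0 := by
  simp only [normalComponent, lorentz_add_left, lorentz_sub_left, lorentz_smul_left, h.A_N hq,
    h.N_N q hq, lorentz_comm (X q), h.N_X q hq]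
  ring

lemma normalComponent_E₁ (hq : q ∈ U) :
    lorentz (normalComponent X f v N q) (along v X q) = 0 := by
  simp only [normalComponent, lorentz_add_left, lorentz_sub_left, lorentz_smul_left,
    h.along_E₁_E₁ hq, h.N_E₁ q hq, lorentz_comm (X q), h.E₁_X hq]
  ring

omit h in
lemma A_eq : along v (along v X) q = normalComponent X f v N q - f q • N q + X q := by
  rw [normalComponent]; module

lemma W_eq (hq : q ∈ U) : along w (along w X) q =
    (3 * f q) • N q + X q + b q • along v X q - normalComponent X f v N q := by
  rw [h.w_E₂ q hq, normalComponent]; module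

/-- Pythagoras for the decomposition `W = 3f N + X + b E₁ - L`; the `-1` comes from the timelike
vector `X`. -/
lemma W_W (hq : q ∈ U) :
    lorentz (along w (along w X) q) (along w (along w X) q) = b q ^ 2 + 9 * f q ^ 2 - 1
      + lorentz (normalComponent X f v N q) (normalComponent X f v N q) := by
  have c1 := lorentz_comm (N q) (normalComponent X f v N q)
  have c2 := lorentz_comm (X q) (normalComponent X f v N q)
  have c3 := lorentz_comm (along v X q) (normalComponent X f v N q)
  have c4 := lorentz_comm (X q) (N q)
  have c5 := lorentz_comm (along v X q) (N q)
  have c6 := lorentz_comm (X q) (along v X q)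
  simp only [h.W_eq hq, lorentz_add_left, lorentz_sub_left, lorentz_smul_left, lorentz_add_right,
    lorentz_sub_right, lorentz_smul_right, c1, c2, c3, c4, c5, c6, h.normalComponent_N hq,
    h.normalComponent_X hq, h.normalComponent_E₁ hq, h.N_X q hq, h.N_E₁ q hq, h.E₁_X hq, h.X_X hq,
    h.N_N q hq, h.E₁_E₁ hq]
  ring

lemma w_W_aux (hq : q ∈ U) : along w (along w (along w X)) q
    = (-6 * f q ^ 2 + 2 - 2 * b q ^ 2 + along v b q) • along w X q := by
  have sf : SmoothAt U fun q => 2 * f q := (SmoothAt.const _).mul h.smooth_f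
  have s1 : SmoothAt U fun q => (2 * f q) • N q := sf.smul h.smooth_N
  have s2 : SmoothAt U fun q => (2 : ℝ) • X q := (SmoothAt.const _).smul h.smooth
  have s3 : SmoothAt U fun q => b q • along v X q := h.smooth_b.smul h.smooth_E₁
  rw [along_congr (v := w) h.isOpen hq h.w_E₂,
    along_sub (((s1.add s2).add s3).diff hq) (h.smooth_A.diff hq),
    along_add ((s1.add s2).diff hq) (s3.diff hq), along_add (s1.diff hq) (s2.diff hq),
    along_smul (sf.diff hq) (h.smooth_N.diff hq),
    along_smul ((SmoothAt.const (U := U) (2 : ℝ)).diff hq) (h.smooth.diff hq),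
    along_smul (h.smooth_b.diff hq) (h.smooth_E₁.diff hq),
    along_mul ((SmoothAt.const (U := U) (2 : ℝ)).diff hq) (h.smooth_f.diff hq),
    along_const, h.along_w_eq q hq, h.w_b hq, h.w_N q hq, h.w_E₁ q hq, h.w_A hq]
  module

/-- `D_w W` is already known to be a multiple of `E₂`; differentiating `⟨W, E₂⟩ = 0` identifies the
factor. The `w`-curves thus satisfy the equation of a plane circle. -/
lemma w_W (hq : q ∈ U) : along w (along w (along w X)) q
    = -lorentz (along w (along w X) q) (along w (along w X) q) • along w X q := by
  have h1 := lorentz_along_of_const (u := w) h.isOpen hq h.smooth_W h.smooth_E₂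
    fun q hq => h.along_E₂_E₂ hq w
  rw [h.w_W_aux hq, lorentz_smul_left, h.E₂_E₂ hq, mul_one] at h1
  rw [h.w_W_aux hq, h1]

/-- The Gauss equation, obtained by equating the two expressions for the factor of `E₂` in `D_w W`.
-/
lemma v_b (hq : q ∈ U) : along v b q = b q ^ 2 - 1 - 3 * f q ^ 2
    - lorentz (normalComponent X f v N q) (normalComponent X f v N q) := by
  have h1 := lorentz_along_of_const (u := w) h.isOpen hq h.smooth_W h.smooth_E₂
    fun q hq => h.along_E₂_E₂ hq w
  rw [h.w_W_aux hq, lorentz_smul_left, h.E₂_E₂ hq, h.W_W hq] at h1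
  linarith

lemma v_W_W (hq : q ∈ U) :
    along v (fun q => lorentz (along w (along w X) q) (along w (along w X) q)) q
      = 2 * b q * lorentz (along w (along w X) q) (along w (along w X) q) := by
  rw [along_lorentz (h.smooth_W.diff hq) (h.smooth_W.diff hq), h.v_W hq, lorentz_smul_left,
    lorentz_smul_right]
  ring

lemma w_W_W (hq : q ∈ U) :
    along w (fun q => lorentz (along w (along w X) q) (along w (along w X) q)) q = 0 := by
  rw [along_lorentz (h.smooth_W.diff hq) (h.smooth_W.diff hq), h.w_W hq, lorentz_smul_left,
    lorentz_smul_right, lorentz_comm (along w X q), h.along_E₂_E₂ hq]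
  ring

lemma along_b_sq (hq : q ∈ U) (u : Plane → Plane) :
    along u (fun q => b q ^ 2) q = 2 * b q * along u b q := by
  rw [along_comp (φ := fun x => x ^ 2) (hasDerivAt_pow 2 (b q)) (h.smooth_b.diff hq)]
  simp

lemma along_f_sq (hq : q ∈ U) (u : Plane → Plane) :
    along u (fun q => 9 * f q ^ 2) q = 18 * f q * along u f q := by
  rw [along_comp (φ := fun x => 9 * x ^ 2) ((hasDerivAt_pow 2 (f q)).const_mul 9)
    (h.smooth_f.diff hq)]
  push_cast; ring

lemma along_normalComponent (hq : q ∈ U) (u : Plane → Plane) :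
    along u (fun q => lorentz (normalComponent X f v N q) (normalComponent X f v N q)) q
      = along u (fun q => lorentz (along w (along w X) q) (along w (along w X) q)) q
        - 2 * b q * along u b q - 18 * f q * along u f q := by
  have e : ∀ q ∈ U, lorentz (along w (along w X) q) (along w (along w X) q)
      = b q ^ 2 + 9 * f q ^ 2 - 1
        + lorentz (normalComponent X f v N q) (normalComponent X f v N q) := fun q hq => h.W_W hq
  have s1 : SmoothAt U fun q => b q ^ 2 := fun q hq => (h.smooth_b q hq).pow 2
  have s2 : SmoothAt U fun q => 9 * f q ^ 2 := fun q hq =>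
    contDiffAt_const.mul ((h.smooth_f q hq).pow 2)
  have s3 := h.smooth_normalComponent.lorentz h.smooth_normalComponent
  have s0 : SmoothAt U fun _ => (1 : ℝ) := SmoothAt.const _
  rw [along_congr h.isOpen hq e, along_add (((s1.add s2).sub s0).diff hq) (s3.diff hq),
    along_sub ((s1.add s2).diff hq) (s0.diff hq), along_add (s1.diff hq) (s2.diff hq),
    h.along_b_sq hq, h.along_f_sq hq, along_const]
  ring

/-- Differentiating Pythagoras for `W` and inserting the Gauss equation, all terms without `|L|²`
cancel. -/
lemma v_normalComponent (hq : q ∈ U) :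
    along v (fun q => lorentz (normalComponent X f v N q) (normalComponent X f v N q)) q
      = 4 * b q * lorentz (normalComponent X f v N q) (normalComponent X f v N q) := by
  rw [h.along_normalComponent hq, h.v_W_W hq, h.v_b hq, h.along_f q hq, h.W_W hq]
  ring

lemma w_normalComponent (hq : q ∈ U) :
    along w (fun q => lorentz (normalComponent X f v N q) (normalComponent X f v N q)) q = 0 := by
  rw [h.along_normalComponent hq, h.w_W_W hq, h.w_b hq, h.along_w_eq q hq]
  ring

lemma along_rpow_f (hq : q ∈ U) (u : Plane → Plane) (p : ℝ) :
    along u (fun q => f q ^ p) q = p * f q ^ (p - 1) * along u f q :=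
  along_comp (φ := fun x => x ^ p) (Real.hasDerivAt_rpow_const (.inl (h.f_pos q hq).ne'))
    (h.smooth_f.diff hq)

lemma v_rpow_f (hq : q ∈ U) (p : ℝ) :
    along v (fun q => f q ^ p) q = 4 / 3 * p * b q * f q ^ p := by
  have hf := h.f_pos q hq
  rw [h.along_rpow_f hq, h.along_f q hq, Real.rpow_sub_one hf.ne']
  field_simp

lemma w_rpow_f (hq : q ∈ U) (p : ℝ) : along w (fun q => f q ^ p) q = 0 := by
  rw [h.along_rpow_f hq, h.along_w_eq q hq, mul_zero]

/-- A function with logarithmic derivative `p b` in the direction `v`, and constant in the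
direction `w`, is a constant multiple of `f ^ (3p/4)`. -/
lemma eq_mul_rpow (hU : IsPreconnected U) {g : Plane → ℝ} (hg : SmoothAt U g) (p : ℝ)
    (h1 : ∀ q ∈ U, along v g q = 4 / 3 * p * b q * g q) (h2 : ∀ q ∈ U, along w g q = 0) :
    ∃ k, ∀ q ∈ U, g q = k * f q ^ p := by
  rcases U.eq_empty_or_nonempty with rfl | ⟨x, hx⟩
  · exact ⟨0, fun q hq => absurd hq (Set.notMem_empty q)⟩
  have sp : SmoothAt U fun q => f q ^ (-p) := h.smooth_f.rpow (fun q hq => (h.f_pos q hq).ne') _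
  refine ⟨g x * f x ^ (-p), fun q hq => ?_⟩
  -- `f^(-p)` is an integrating factor: the product `g f^(-p)` has vanishing derivatives in both
  -- frame directions.
  rw [← h.eq_of_along_eq_zero hU (hg.mul sp) (fun y hy => ?_) (fun y hy => ?_) hq hx, mul_assoc,
    ← Real.rpow_add (h.f_pos q hq), neg_add_cancel, Real.rpow_zero, mul_one]
  · rw [along_mul (hg.diff hy) (sp.diff hy), h1 y hy, h.v_rpow_f hy]; ring
  · rw [along_mul (hg.diff hy) (sp.diff hy), h2 y hy, h.w_rpow_f hy]; ring

/-- The two integration constants of the surface. -/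
lemma exists_constants (hU : IsPreconnected U) : ∃ k C : ℝ, ∀ q ∈ U,
    lorentz (normalComponent X f v N q) (normalComponent X f v N q) = k * f q ^ 3 ∧
    lorentz (along w (along w X) q) (along w (along w X) q) = 9 * C * f q ^ (3 / 2 : ℝ) ∧
    b q ^ 2 = 1 + 9 * C * f q ^ (3 / 2 : ℝ) - 9 * f q ^ 2 - k * f q ^ 3 := by
  obtain ⟨k, hk⟩ := h.eq_mul_rpow hU (h.smooth_normalComponent.lorentz h.smooth_normalComponent) 3
    (fun q hq => by rw [h.v_normalComponent hq]; ring) (fun q hq => h.w_normalComponent hq)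
  obtain ⟨C, hC⟩ := h.eq_mul_rpow hU (h.smooth_W.lorentz h.smooth_W) (3 / 2)
    (fun q hq => by rw [h.v_W_W hq]; ring) (fun q hq => h.w_W_W hq)
  -- The division by `9` matches the normalization `|W|² = 9C f^(3/2)`.
  refine ⟨k, C / 9, fun q hq => ?_⟩
  have e1 := hk q hq
  have e2 := hC q hq
  have e3 := h.W_W hq
  have e4 : f q ^ (3 : ℝ) = f q ^ 3 := by exact_mod_cast Real.rpow_natCast (f q) 3
  rw [e4] at e1
  exact ⟨e1, by rw [e2]; ring, by linarith⟩

lemma gradNorm_eq (hq : q ∈ U) : gradNorm X f q = 4 / 3 * f q * b q := by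
  have h1 := (h.orthonormal q hq).gradNorm_eq f
  change _ = √(along v f q ^ 2 + along w f q ^ 2) at h1
  rw [h1, h.along_w_eq q hq, ← h.along_f q hq]
  simpa using Real.sqrt_sq (h.along_v_pos q hq).le

omit h in
/-- Orthogonal projection onto the span of `X`, `E₁`, `E₂`, `N`. -/
def frameProj (X : Plane → R51) (v w : Plane → Plane) (N : Plane → R51) (z : R51) (q : Plane) :
    R51 :=
  lorentz z (along v X q) • along v X q + lorentz z (along w X q) • along w X q
    + lorentz z (N q) • N q - lorentz z (X q) • X q

omit h in
lemma along_lorentz_smul (hq : q ∈ U) (u : Plane → Plane) (z : R51) {V : Plane → R51}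
    (hV : SmoothAt U V) : along u (fun q => lorentz z (V q) • V q) q
      = lorentz z (along u V q) • V q + lorentz z (V q) • along u V q := by
  have hz : SmoothAt U fun _ => z := .const z
  rw [along_smul ((hz.lorentz hV).diff hq) (hV.diff hq), along_lorentz (hz.diff hq) (hV.diff hq),
    along_const, lorentz_zero_left, zero_add]

/-- When `L = 0`, the structure equations of `X, E₁, E₂, N` form a closed system with skew-adjoint
coefficients, so the projection onto their span does not vary. -/
lemma along_frameProj (hq : q ∈ U) (hL : normalComponent X f v N q = 0) (z : R51) :
    along v (frameProj X v w N z) q = 0 ∧ along w (frameProj X v w N z) q = 0 := by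
  have hz : SmoothAt U fun _ => z := .const z
  have s1 := (hz.lorentz h.smooth_E₁).smul h.smooth_E₁
  have s2 := (hz.lorentz h.smooth_E₂).smul h.smooth_E₂
  have s3 := (hz.lorentz h.smooth_N).smul h.smooth_N
  have s4 := (hz.lorentz h.smooth).smul h.smooth
  have hD (u : Plane → Plane) : along u (frameProj X v w N z) q = _ :=
    (along_sub (((s1.add s2).add s3).diff hq) (s4.diff hq)).trans <| by
      rw [along_add ((s1.add s2).diff hq) (s3.diff hq), along_add (s1.diff hq) (s2.diff hq),
        along_lorentz_smul hq u z h.smooth_E₁, along_lorentz_smul hq u z h.smooth_E₂,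
        along_lorentz_smul hq u z h.smooth_N, along_lorentz_smul hq u z h.smooth]
  have hA := A_eq (X := X) (f := f) (v := v) (N := N) (q := q)
  have hW := h.W_eq hq
  rw [hL] at hA hW
  constructor
  · rw [hD, hA, h.v_E₂ q hq, h.v_N q hq]
    simp only [lorentz_add_right, lorentz_sub_right, lorentz_smul_right, lorentz_zero_right]
    module
  · rw [hD, hW, h.w_E₁ q hq, h.w_N q hq]
    simp only [lorentz_add_right, lorentz_sub_right, lorentz_smul_right, lorentz_zero_right]
    module

/-- If the second fundamental form only has a component in the direction of the mean curvature,
the surface lies in a totally geodesic hypersurface. -/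
lemma exists_totallyGeodesic (hU : IsPreconnected U) {x : Plane} (hx : x ∈ U)
    (hL : ∀ q ∈ U, normalComponent X f v N q = 0) :
    ∃ ν : R51, 0 < lorentz ν ν ∧ ∀ q ∈ U, lorentz (X q) ν = 0 := by
  have hz (z : R51) : SmoothAt U fun _ => z := .const z
  have sP (z : R51) : SmoothAt U (frameProj X v w N z) :=
    ((((hz z).lorentz h.smooth_E₁).smul h.smooth_E₁).add
      (((hz z).lorentz h.smooth_E₂).smul h.smooth_E₂)).add
      (((hz z).lorentz h.smooth_N).smul h.smooth_N) |>.sub (((hz z).lorentz h.smooth).smul h.smooth)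
  have hconst (z : R51) {q : Plane} (hq : q ∈ U) :
      frameProj X v w N z x = frameProj X v w N z q :=
    h.eq_of_along_eq_zero hU (sP z) (fun q hq => (h.along_frameProj hq (hL q hq) z).1)
      (fun q hq => (h.along_frameProj hq (hL q hq) z).2) hx hq
  -- Four vectors cannot span a five-dimensional space. The difference is a constant vector
  -- orthogonal to every `X q`; being orthogonal to a point of `ℍ⁴`, it is spacelike.
  obtain ⟨z, hne⟩ : ∃ z, z - frameProj X v w N z x ≠ 0 := by
    by_contra hcon
    push Not at hcon
    have hspan : Submodule.span ℝ (Set.range ![along v X x, along w X x, N x, X x]) = ⊤ := by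
      rw [eq_top_iff]
      intro z _
      have hm (i : Fin 4) : ![along v X x, along w X x, N x, X x] i ∈
          Submodule.span ℝ (Set.range ![along v X x, along w X x, N x, X x]) :=
        Submodule.subset_span ⟨i, rfl⟩
      rw [sub_eq_zero.1 (hcon z), frameProj]
      exact Submodule.sub_mem _ (Submodule.add_mem _ (Submodule.add_mem _
        (Submodule.smul_mem _ _ (hm 0)) (Submodule.smul_mem _ _ (hm 1)))
        (Submodule.smul_mem _ _ (hm 2))) (Submodule.smul_mem _ _ (hm 3))
    have h1 := finrank_range_le_card (R := ℝ) ![along v X x, along w X x, N x, X x]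
    rw [Set.finrank, hspan, finrank_top] at h1
    simp at h1
  have hX : ∀ q ∈ U, lorentz (X q) (z - frameProj X v w N z x) = 0 := by
    intro q hq
    rw [hconst z hq, frameProj, lorentz_comm]
    simp only [lorentz_sub_left, lorentz_add_left, lorentz_smul_left, h.X_X hq, h.E₁_X hq,
      h.E₂_X hq, h.N_X q hq]
    ring
  exact ⟨_, lorentz_self_pos (h.mem_H4 x hx) (by rw [lorentz_comm]; exact hX x hx) hne, hX⟩

end IsPNMCFrame

/-! ### Commuting fields and the coordinates `(u, t)`. -/

/-- The coordinate rectangle. -/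
def rect (ε δ : ℝ) : Set Plane := {q | q 0 ∈ Set.Ioo (-ε) ε ∧ q 1 ∈ Set.Ioo (-δ) δ}

lemma isOpen_rect (ε δ : ℝ) : IsOpen (rect ε δ) :=
  (isOpen_Ioo.preimage (by fun_prop : Continuous fun q : Plane => q 0)).inter
    (isOpen_Ioo.preimage (by fun_prop : Continuous fun q : Plane => q 1))

lemma exists_rect_subset {s : Set Plane} (hs : s ∈ nhds (0 : Plane)) :
    ∃ ε > 0, rect ε ε ⊆ s := by
  obtain ⟨ε, hε, h⟩ := Metric.mem_nhds_iff.1 hs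
  refine ⟨ε / 2, half_pos hε, fun q hq => h ?_⟩
  obtain ⟨h0, h1⟩ := hq
  have e0 := abs_lt.2 h0
  have e1 := abs_lt.2 h1
  rw [mem_ball_zero_iff, EuclideanSpace.norm_eq, Fin.sum_univ_two,
    Real.sqrt_lt' hε, Real.norm_eq_abs, Real.norm_eq_abs]
  nlinarith [abs_nonneg (q 0), abs_nonneg (q 1)]

/-- A local inverse of a smooth map with injective differentials, defined on a rectangle. -/
lemma exists_localInverse {U : Set Plane} {ψ : Plane → Plane} {x : Plane} (hU : IsOpen U)
    (hx : x ∈ U) (hψ : SmoothAt U ψ) (hinj : ∀ q ∈ U, ∀ y, fderiv ℝ ψ q y = 0 → y = 0)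
    (h0 : ψ x = 0) : ∃ (ε : ℝ) (Ψ : OpenPartialHomeomorph Plane Plane), 0 < ε ∧ x ∈ Ψ.source ∧
      Ψ.source ⊆ U ∧ Ψ.target = rect ε ε ∧ (∀ q, Ψ q = ψ q) ∧ SmoothAt Ψ.target Ψ.symm := by
  have heq : ∀ q ∈ U, ∃ L : Plane ≃L[ℝ] Plane, HasFDerivAt ψ (L : Plane →L[ℝ] Plane) q := by
    intro q hq
    refine ⟨(LinearEquiv.ofInjectiveEndo (fderiv ℝ ψ q : Plane →ₗ[ℝ] Plane)
      ((injective_iff_map_eq_zero _).2 (hinj q hq))).toContinuousLinearEquiv, ?_⟩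
    exact (hψ.diff hq).hasFDerivAt
  obtain ⟨L, hL⟩ := heq x hx
  let e0 := (hψ x hx).toOpenPartialHomeomorph ψ hL (by simp)
  let e1 := e0.restrOpen U hU
  have hx1 : x ∈ e1.source := ⟨(hψ x hx).mem_toOpenPartialHomeomorph_source hL (by simp), hx⟩
  have ht : e1.target ∈ nhds (0 : Plane) := by
    rw [← h0]; exact e1.open_target.mem_nhds (e1.map_source hx1)
  obtain ⟨ε, hε, hsub⟩ := exists_rect_subset ht
  -- The restriction is made on the inverse map, so that the image of the chart is exactly a
  -- rectangle.
  let e2 := e1.symm.restrOpen (rect ε ε) (isOpen_rect ε ε)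
  have hsrc : e2.source = rect ε ε := Set.inter_eq_right.2 hsub
  have hmem : ∀ q ∈ e2.target, q ∈ e1.source := fun q hq => hq.1
  refine ⟨ε, e2.symm, hε, ?_, fun q hq => (hmem q hq).2, hsrc, fun q => rfl, ?_⟩
  · refine ⟨hx1, ?_⟩
    change ψ x ∈ rect ε ε
    rw [h0]
    simpa [rect] using hε
  · intro p hp
    have hp' : p ∈ e1.target := by
      have : p ∈ e2.source := hp
      rw [hsrc] at this
      exact hsub this
    have hmU := e1.map_target hp'
    obtain ⟨L', hL'⟩ := heq _ hmU.2
    exact e1.contDiffAt_symm hp' hL' (hψ _ hmU.2)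

lemma smoothAt_of_hasFDerivAt {U : Set Plane} (hU : IsOpen U) {u : Plane → ℝ}
    {θ : Plane → Plane →L[ℝ] ℝ} (hθ : SmoothAt U θ) (h : ∀ q ∈ U, HasFDerivAt u (θ q) q) :
    SmoothAt U u := by
  have h1 : ContDiffOn ℝ ∞ u U := by
    rw [contDiffOn_infty_iff_fderiv_of_isOpen hU]
    refine ⟨fun q hq => (h q hq).differentiableAt.differentiableWithinAt, fun q hq => ?_⟩
    exact ((hθ q hq).congr_of_eventuallyEq
      (Filter.eventually_of_mem (hU.mem_nhds hq) fun y hy => (h y hy).fderiv)).contDiffWithinAt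
  exact fun q hq => h1.contDiffAt (hU.mem_nhds hq)

/-- A `1`-form `⟨E, dX⟩` on a convex domain is exact if it is closed. -/
lemma IsGradientFrame.exists_primitive {U : Set Plane} {X : Plane → R51} {f : Plane → ℝ}
    {v w : Plane → Plane} (h : IsGradientFrame U X f v w) (hU : Convex ℝ U) {E : Plane → R51}
    (hE : SmoothAt U E) (hc : ∀ q ∈ U,
      lorentz (along v E q) (along w X q) = lorentz (along w E q) (along v X q))
    (x : Plane) : ∃ u : Plane → ℝ, u x = 0 ∧ SmoothAt U u ∧
      ∀ q ∈ U, ∀ y, fderiv ℝ u q y = lorentz (E q) (fderiv ℝ X q y) := by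
  let θ : Plane → Plane →L[ℝ] ℝ := fun q => (lorentzL (E q)).comp (fderiv ℝ X q)
  have hLE : SmoothAt U fun q => lorentzL (E q) := fun q hq =>
    lorentzL.contDiff.contDiffAt.comp q (hE q hq)
  have hθ : SmoothAt U θ := fun q hq => (hLE q hq).clm_comp (h.smooth.fderiv q hq)
  have hdθ : ∀ q ∈ U, ∀ y z, fderiv ℝ θ q y z = lorentz (E q) (fderiv ℝ (fderiv ℝ X) q y z)
      + lorentz (fderiv ℝ E q y) (fderiv ℝ X q z) := by
    intro q hq y z
    have e1 : fderiv ℝ (fun q => lorentzL (E q)) q = lorentzL.comp (fderiv ℝ E q) :=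
      (lorentzL.hasFDerivAt.comp q (hE.diff hq).hasFDerivAt).fderiv
    have e2 := fderiv_clm_comp (hLE.diff hq) (h.smooth.fderiv.diff hq)
    simp only [θ]
    rw [e2, e1]
    simp
  obtain ⟨u, hu⟩ := hU.exists_forall_hasFDerivAt_of_fderiv_symmetric h.isOpen
    (fun q hq => (hθ.diff hq).differentiableWithinAt) (fun q hq y z => by
      have hs : fderiv ℝ (fderiv ℝ X) q y z = fderiv ℝ (fderiv ℝ X) q z y :=
        (h.smooth q hq).isSymmSndFDerivAt
          (by simpa using (WithTop.coe_le_coe.2 le_top : ((2 : ℕ∞) : ℕ∞ω) ≤ ∞)) _ _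
      rw [hdθ q hq, hdθ q hq, hs, h.fderiv_eq hq E y, h.fderiv_eq hq E z]
      have hy := h.fderiv_eq hq X y
      have hz := h.fderiv_eq hq X z
      generalize lorentz (fderiv ℝ X q y) (along v X q) = y1 at *
      generalize lorentz (fderiv ℝ X q y) (along w X q) = y2 at *
      generalize lorentz (fderiv ℝ X q z) (along v X q) = z1 at *
      generalize lorentz (fderiv ℝ X q z) (along w X q) = z2 at *
      rw [hy, hz]
      simp only [lorentz_add_left, lorentz_smul_left, lorentz_add_right, lorentz_smul_right]
      -- On a surface `dθ` has one component: the area form of the frame times the assumed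
      -- difference.
      linear_combination (y1 * z2 - y2 * z1) * hc q hq)
  refine ⟨fun q => u q - u x, sub_self _, ?_, fun q hq y => ?_⟩
  · exact smoothAt_of_hasFDerivAt h.isOpen hθ fun q hq => (hu q hq).sub_const _
  · rw [((hu q hq).sub_const (u x)).fderiv]; rfl

/-- Coordinates on a rectangle around `x`, with coordinate fields `v` and `κ⁻¹ w`. -/
structure IsAdaptedChart (U : Set Plane) (v w : Plane → Plane) (κ t : Plane → ℝ) (x : Plane)
    (ε : ℝ) (Ψ : OpenPartialHomeomorph Plane Plane) : Prop where
  pos : 0 < ε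
  mem_source : x ∈ Ψ.source
  source_subset : Ψ.source ⊆ U
  target_eq : Ψ.target = rect ε ε
  map_zero : Ψ x = 0
  smooth : SmoothAt Ψ.source Ψ
  smooth_symm : SmoothAt Ψ.target Ψ.symm
  map_one : ∀ q, Ψ q 1 = t q
  smooth_t : SmoothAt U t
  along_v_t : ∀ q ∈ U, along v t q = 0
  along_w_t : ∀ q ∈ U, along w t q = κ q
  fderiv_zero : ∀ p ∈ rect ε ε,
    fderiv ℝ Ψ.symm p (EuclideanSpace.single 0 1) = v (Ψ.symm p)
  fderiv_one : ∀ p ∈ rect ε ε,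
    fderiv ℝ Ψ.symm p (EuclideanSpace.single 1 1) = (κ (Ψ.symm p))⁻¹ • w (Ψ.symm p)

/-- As `[v,w] = b w` and `vκ = bκ`, the fields `v` and `κ⁻¹w` commute. Equivalently, the dual forms
`⟨E₁, dX⟩` and `κ⟨E₂, dX⟩` are closed; their primitives are the coordinates `u` and `t`. -/
lemma IsPNMCFrame.exists_adaptedChart {U : Set Plane} {X : Plane → R51} {f b : Plane → ℝ}
    {v w : Plane → Plane} {N : Plane → R51} (h : IsPNMCFrame U X f b v w N) (hU : Convex ℝ U)
    {κ : Plane → ℝ} (hκ : SmoothAt U κ) (hpos : ∀ q ∈ U, 0 < κ q)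
    (hv : ∀ q ∈ U, along v κ q = b q * κ q) {x : Plane} (hx : x ∈ U) :
    ∃ t ε Ψ, IsAdaptedChart U v w κ t x ε Ψ := by
  obtain ⟨u, u0, su, du⟩ := h.exists_primitive hU h.smooth_E₁
    (fun q hq => by rw [h.A_E₂ hq, h.along_E₁_E₁ hq]) x
  obtain ⟨t, t0, st, dt⟩ := h.exists_primitive hU (hκ.smul h.smooth_E₂)
    (fun q hq => by
      rw [along_smul (hκ.diff hq) (h.smooth_E₂.diff hq),
        along_smul (hκ.diff hq) (h.smooth_E₂.diff hq), h.v_E₂ q hq, hv q hq, smul_zero, add_zero,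
        lorentz_smul_left, lorentz_add_left, lorentz_smul_left, lorentz_smul_left,
        lorentz_comm (along w X q) (along v X q), h.E₁_E₂ hq, h.E₂_E₂ hq, h.W_E₁ hq]
      ring) x
  let ψ : Plane → Plane := fun q => WithLp.toLp 2 ![u q, t q]
  have sψ : SmoothAt U ψ := by
    intro q hq
    rw [contDiffAt_euclidean]
    intro i
    fin_cases i
    · exact su q hq
    · exact st q hq
  have dψ : ∀ q ∈ U, ∀ y, fderiv ℝ ψ q y = WithLp.toLp 2 ![fderiv ℝ u q y, fderiv ℝ t q y] := by
    intro q hq y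
    have (i : Fin 2) : fderiv ℝ (fun q => ψ q i) q y = fderiv ℝ ψ q y i := congrArg (fun L => L y)
      ((EuclideanSpace.proj (𝕜 := ℝ) i).hasFDerivAt.comp q (sψ.diff hq).hasFDerivAt).fderiv
    refine PiLp.ext fun i => ?_
    fin_cases i
    · exact (this 0).symm
    · exact (this 1).symm
  have dut : ∀ q ∈ U, fderiv ℝ u q (v q) = 1 ∧ fderiv ℝ u q (w q) = 0 ∧
      fderiv ℝ t q (v q) = 0 ∧ fderiv ℝ t q (w q) = κ q := by
    intro q hq
    have c := lorentz_comm (along w X q) (along v X q)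
    refine ⟨?_, ?_, ?_, ?_⟩
    · rw [du q hq]; exact h.E₁_E₁ hq
    · rw [du q hq]; exact h.E₁_E₂ hq
    · rw [dt q hq, lorentz_smul_left]
      change κ q * lorentz (along w X q) (along v X q) = 0
      rw [c, h.E₁_E₂ hq, mul_zero]
    · rw [dt q hq, lorentz_smul_left]
      change κ q * lorentz (along w X q) (along w X q) = κ q
      rw [h.E₂_E₂ hq, mul_one]
  have hinj : ∀ q ∈ U, ∀ y, fderiv ℝ ψ q y = 0 → y = 0 := by
    intro q hq y hy
    rw [dψ q hq] at hy
    have e0 : fderiv ℝ u q y = 0 := congrArg (fun p : Plane => p 0) hy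
    have e1 : fderiv ℝ t q y = 0 := congrArg (fun p : Plane => p 1) hy
    rw [du q hq, lorentz_comm] at e0
    rw [dt q hq, lorentz_smul_left] at e1
    have e2 := (mul_eq_zero.1 e1).resolve_left (hpos q hq).ne'
    rw [lorentz_comm] at e2
    rw [(h.orthonormal q hq).eq_frame y]
    change lorentz (fderiv ℝ X q y) (along v X q) • v q
      + lorentz (fderiv ℝ X q y) (along w X q) • w q = 0
    rw [e0, e2]; simp
  obtain ⟨ε, Ψ, hε, hxΨ, hsub, htar, hΨ, hsymm⟩ := exists_localInverse h.isOpen hx sψ hinj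
    (by simp only [ψ, u0, t0]; ext i; fin_cases i <;> rfl)
  have hΨ' : (Ψ : Plane → Plane) = ψ := funext hΨ
  -- `dψ` sends `v` and `κ⁻¹w` to the standard basis, so inverting it gives the coordinate fields.
  have key : ∀ p ∈ rect ε ε, ∀ y, fderiv ℝ Ψ.symm p (fderiv ℝ ψ (Ψ.symm p) y) = y := by
    intro p hp y
    rw [← htar] at hp
    have hm := hsub (Ψ.map_target hp)
    have h1 : (Ψ.symm ∘ ψ) =ᶠ[nhds (Ψ.symm p)] id :=
      Filter.eventually_of_mem (Ψ.open_source.mem_nhds (Ψ.map_target hp)) fun z hz => by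
        simpa [hΨ z] using Ψ.left_inv hz
    have hpp : ψ (Ψ.symm p) = p := by rw [← hΨ]; exact Ψ.right_inv hp
    have h2 := fderiv_comp (Ψ.symm p) (g := Ψ.symm) (f := ψ)
      (by rw [hpp]; exact hsymm.diff hp) (sψ.diff hm)
    rw [h1.fderiv_eq, hpp, fderiv_id] at h2
    exact (congrArg (fun L => L y) h2).symm
  refine ⟨t, ε, Ψ, hε, hxΨ, hsub, htar, ?_, ?_, hsymm, fun q => ?_, st, fun q hq => (dut q hq).2.2.1,
    fun q hq => (dut q hq).2.2.2, ?_, ?_⟩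
  · rw [hΨ]; simp only [ψ, u0, t0]; ext i; fin_cases i <;> rfl
  · rw [hΨ']; exact sψ.mono hsub
  · rw [hΨ]; rfl
  · intro p hp
    have hm := hsub (Ψ.map_target (htar ▸ hp))
    obtain ⟨a1, _, a3, _⟩ := dut _ hm
    conv_rhs => rw [← key p hp (v (Ψ.symm p)), dψ _ hm, a1, a3]
    congr 1
    ext i; fin_cases i <;> simp
  · intro p hp
    have hm := hsub (Ψ.map_target (htar ▸ hp))
    obtain ⟨_, a2, _, a4⟩ := dut _ hm
    have hk := (hpos _ hm).ne'
    conv_rhs => rw [← key p hp (w (Ψ.symm p)), dψ _ hm, a2, a4, ← map_smul]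
    congr 1
    ext i; fin_cases i <;> simp [hk]

namespace IsAdaptedChart

variable {U : Set Plane} {v w : Plane → Plane} {κ t : Plane → ℝ} {x : Plane}
    {ε : ℝ} {Ψ : OpenPartialHomeomorph Plane Plane} (h : IsAdaptedChart U v w κ t x ε Ψ)
    {F : Type*} [NormedAddCommGroup F] [NormedSpace ℝ F]

lemma toLp_mem_rect (hε : 0 < ε) {s : ℝ} (hs : s ∈ Set.Ioo (-ε) ε) :
    (WithLp.toLp 2 ![s, 0] : Plane) ∈ rect ε ε := ⟨by simpa using hs, by simpa using hε⟩

include h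

lemma symm_mem {p : Plane} (hp : p ∈ rect ε ε) : Ψ.symm p ∈ U :=
  h.source_subset (Ψ.map_target (h.target_eq ▸ hp))

/-- The coordinate line `s ↦ (s, 0)` is an integral curve of `v`. -/
lemma hasDerivAt_line {g : Plane → F} (hg : SmoothAt U g) {s : ℝ} (hs : s ∈ Set.Ioo (-ε) ε) :
    HasDerivAt (fun s => g (Ψ.symm (WithLp.toLp 2 ![s, 0])))
      (along v g (Ψ.symm (WithLp.toLp 2 ![s, 0]))) s := by
  have hp := toLp_mem_rect h.pos hs
  have h1 : HasDerivAt (fun s : ℝ => (WithLp.toLp 2 ![s, 0] : Plane))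
      (EuclideanSpace.single 0 1) s := by
    have := ((hasDerivAt_id s).smul_const (EuclideanSpace.single (0 : Fin 2) (1 : ℝ)))
    rw [one_smul] at this
    refine this.congr_of_eventuallyEq (Filter.Eventually.of_forall fun r => ?_)
    ext i; fin_cases i <;> simp
  have h2 := (h.smooth_symm.diff (h.target_eq ▸ hp)).hasFDerivAt.comp_hasDerivAt s h1
  rw [h.fderiv_zero _ hp] at h2
  exact (hg.diff (h.symm_mem hp)).hasFDerivAt.comp_hasDerivAt s h2

/-- Functions annihilated by `w` only depend on the first coordinate. -/
lemma eq_of_along_w_eq_zero {g : Plane → F} (hg : SmoothAt U g)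
    (h0 : ∀ q ∈ U, along w g q = 0) {p : Plane} (hp : p ∈ rect ε ε) :
    g (Ψ.symm p) = g (Ψ.symm (WithLp.toLp 2 ![p 0, 0])) := by
  have hmem : ∀ s ∈ Set.Ioo (-ε) ε, (WithLp.toLp 2 ![p 0, s] : Plane) ∈ rect ε ε :=
    fun s hs => ⟨by simpa using hp.1, by simpa using hs⟩
  have hd : ∀ s ∈ Set.Ioo (-ε) ε,
      HasDerivAt (fun s => g (Ψ.symm (WithLp.toLp 2 ![p 0, s]))) 0 s := by
    intro s hs
    have h1 : HasDerivAt (fun s : ℝ => (WithLp.toLp 2 ![p 0, s] : Plane))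
        (EuclideanSpace.single 1 1) s := by
      have := ((hasDerivAt_id s).smul_const (EuclideanSpace.single (1 : Fin 2) (1 : ℝ))).add_const
        (EuclideanSpace.single (0 : Fin 2) (p 0))
      rw [one_smul] at this
      refine this.congr_of_eventuallyEq (Filter.Eventually.of_forall fun r => ?_)
      ext i; fin_cases i <;> simp
    have h2 := (h.smooth_symm.diff (h.target_eq ▸ hmem s hs)).hasFDerivAt.comp_hasDerivAt s h1
    rw [h.fderiv_one _ (hmem s hs)] at h2
    have h3 := (hg.diff (h.symm_mem (hmem s hs))).hasFDerivAt.comp_hasDerivAt s h2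
    rw [map_smul] at h3
    change HasDerivAt _ (_ • along w g _) s at h3
    rw [h0 _ (h.symm_mem (hmem s hs)), smul_zero] at h3
    exact h3
  have hz : (0 : ℝ) ∈ Set.Ioo (-ε) ε := ⟨by linarith [h.pos], h.pos⟩
  have := isOpen_Ioo.is_const_of_deriv_eq_zero isPreconnected_Ioo
    (fun s hs => (hd s hs).differentiableAt.differentiableWithinAt)
    (fun s hs => (hd s hs).deriv) hp.2 hz
  rw [← this]
  congr 2
  ext i; fin_cases i <;> rfl

end IsAdaptedChart

/-! ### Parametrization by circles and Frenet data of the directrix. -/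

namespace IsPNMCFrame

variable {U : Set Plane} {X : Plane → R51} {f b : Plane → ℝ} {v w : Plane → Plane}
  {N : Plane → R51} {q : Plane} (h : IsPNMCFrame U X f b v w N)

include h

/-- Solving the decomposition of `W` for `L` allows `D_v L` to be computed from the known `D_v W = b
W`. -/
lemma v_normalComponent_vec (hq : q ∈ U) : along v (normalComponent X f v N) q
    = (2 * b q) • normalComponent X f v N q
      - lorentz (normalComponent X f v N q) (normalComponent X f v N q) • along v X q := by
  have e : ∀ q ∈ U, normalComponent X f v N q
      = (3 * f q) • N q + X q + b q • along v X q - along w (along w X) q := fun q hq => by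
    rw [h.W_eq hq]; module
  have sf : SmoothAt U fun q => 3 * f q := (SmoothAt.const _).mul h.smooth_f
  have s1 : SmoothAt U fun q => (3 * f q) • N q := sf.smul h.smooth_N
  have s3 : SmoothAt U fun q => b q • along v X q := h.smooth_b.smul h.smooth_E₁
  rw [along_congr h.isOpen hq e,
    along_sub (((s1.add h.smooth).add s3).diff hq) (h.smooth_W.diff hq),
    along_add ((s1.add h.smooth).diff hq) (s3.diff hq), along_add (s1.diff hq) (h.smooth.diff hq),
    along_smul (sf.diff hq) (h.smooth_N.diff hq),
    along_smul (h.smooth_b.diff hq) (h.smooth_E₁.diff hq),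
    along_mul ((SmoothAt.const (U := U) (3 : ℝ)).diff hq) (h.smooth_f.diff hq),
    along_const, h.along_f q hq, h.v_b hq, h.v_N q hq, h.v_W hq, h.W_eq hq,
    A_eq (X := X) (f := f) (v := v) (N := N)]
  module

lemma lorentz_A_sub_X (hq : q ∈ U) :
    lorentz (along v (along v X) q - X q) (along v (along v X) q - X q)
      = lorentz (normalComponent X f v N q) (normalComponent X f v N q) + f q ^ 2 := by
  have e : along v (along v X) q - X q = normalComponent X f v N q - f q • N q := by
    rw [A_eq (X := X) (f := f) (v := v) (N := N)]; abel
  rw [e]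
  simp only [lorentz_sub_left, lorentz_sub_right, lorentz_smul_left, lorentz_smul_right,
    h.normalComponent_N hq, h.N_N q hq, lorentz_comm (N q)]
  ring

omit h in
-- Here `y√(1 + ky)` is the curvature of the `v`-curves as a function of `f`; the derivative is left
-- in logarithmic form.
lemma hasDerivAt_inv_curvature {k y : ℝ} (hk : 0 ≤ k) (hy : 0 < y) :
    HasDerivAt (fun y => (y * √(1 + k * y))⁻¹)
      (-(y * √(1 + k * y))⁻¹ * (y⁻¹ * (1 + k * y / (2 * (1 + k * y))))) y := by
  have hD : 0 < 1 + k * y := by positivity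
  have hr := Real.sqrt_pos.2 hD
  have h1 : HasDerivAt (fun y => 1 + k * y) k y := by
    simpa using ((hasDerivAt_id y).const_mul k).const_add 1
  have h2 := ((hasDerivAt_id y).mul (h1.sqrt hD.ne')).inv (by simpa using ⟨hy.ne', hr.ne'⟩)
  refine h2.congr_deriv ?_
  have e : √(1 + k * y) ^ 2 = 1 + k * y := Real.sq_sqrt hD.le
  simp only [id, Pi.mul_apply]
  generalize √(1 + k * y) = r at *
  rw [← e]
  field_simp

/-- The binormal part of the Frenet equations of the integral curves of `v`. -/
lemma v_principalNormal (hq : q ∈ U) {k : ℝ} (hk : 0 ≤ k)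
    (hL : lorentz (normalComponent X f v N q) (normalComponent X f v N q) = k * f q ^ 3) :
    along v (fun q => (f q * √(1 + k * f q))⁻¹ • (along v (along v X) q - X q)) q
      + (f q * √(1 + k * f q)) • along v X q
      = (2 * b q / (3 * (1 + k * f q)) * (f q * √(1 + k * f q))⁻¹) •
        (normalComponent X f v N q + (k * f q ^ 2) • N q) := by
  have hf := h.f_pos q hq
  have hD : 0 < 1 + k * f q := by positivity
  have hr := Real.sqrt_pos.2 hD
  have e2 : √(1 + k * f q) ^ 2 = 1 + k * f q := Real.sq_sqrt hD.le
  have e : ∀ q ∈ U, along v (along v X) q - X q = normalComponent X f v N q - f q • N q :=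
    fun q _ => by rw [A_eq (X := X) (f := f) (v := v) (N := N)]; abel
  have hφ := hasDerivAt_inv_curvature hk hf
  have hg : DifferentiableAt ℝ (fun q => (f q * √(1 + k * f q))⁻¹) q :=
    hφ.differentiableAt.comp q (h.smooth_f.diff hq)
  have sfN : SmoothAt U fun q => f q • N q := h.smooth_f.smul h.smooth_N
  rw [along_smul hg ((h.smooth_A.sub h.smooth).diff hq),
    along_comp (φ := fun y => (y * √(1 + k * y))⁻¹) hφ (h.smooth_f.diff hq),
    along_congr h.isOpen hq e, along_sub (h.smooth_normalComponent.diff hq) (sfN.diff hq),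
    along_smul (h.smooth_f.diff hq) (h.smooth_N.diff hq), h.v_normalComponent_vec hq,
    h.along_f q hq, h.v_N q hq, e q hq, hL]
  generalize √(1 + k * f q) = r at *
  generalize normalComponent X f v N q = L at *
  -- Eliminating `k` in favour of the root `r` makes every coefficient rational. The resulting
  -- direction `L + k f² N` is orthogonal to the principal normal direction `L - f N`.
  have hk' : k = (r ^ 2 - 1) / f q := by field_simp; linarith
  rw [← e2, hk']
  match_scalars <;> field_simp <;> ring

lemma lorentz_binormal (hq : q ∈ U) {k : ℝ}
    (hL : lorentz (normalComponent X f v N q) (normalComponent X f v N q) = k * f q ^ 3) (r : ℝ) :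
    lorentz (r • (normalComponent X f v N q + (k * f q ^ 2) • N q))
      (r • (normalComponent X f v N q + (k * f q ^ 2) • N q))
      = r ^ 2 * (k * f q ^ 3 * (1 + k * f q)) := by
  simp only [lorentz_add_left, lorentz_add_right, lorentz_smul_left, lorentz_smul_right, hL,
    h.normalComponent_N hq, h.N_N q hq, lorentz_comm (N q)]
  ring

section Coordinates

variable {κ t : Plane → ℝ} {x : Plane} {ε : ℝ} {Ψ : OpenPartialHomeomorph Plane Plane}

/-- The normalized acceleration of the `w`-curves rotates with constant speed. -/
lemma rotation_const (hU : IsPreconnected U) (hχ : IsAdaptedChart U v w κ t x ε Ψ)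
    (sκ : SmoothAt U κ) (hpos : ∀ q ∈ U, 0 < κ q)
    (hv : ∀ q ∈ U, along v κ q = b q * κ q) (hw : ∀ q ∈ U, along w κ q = 0)
    (hW : ∀ q ∈ U, lorentz (along w (along w X) q) (along w (along w X) q) = κ q ^ 2) :
    ∃ b₁ b₂ : R51, lorentz b₁ b₂ = 0 ∧ lorentz b₁ b₁ = 1 ∧ lorentz b₂ b₂ = 1 ∧
      (∀ q ∈ U, along w X q = Real.cos (t q) • b₁ - Real.sin (t q) • b₂ ∧
        (κ q)⁻¹ • along w (along w X) q = -(Real.sin (t q) • b₁ + Real.cos (t q) • b₂)) ∧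
      ∀ p ∈ rect ε ε, X (Ψ.symm p) = X (Ψ.symm (WithLp.toLp 2 ![p 0, 0]))
        + (κ (Ψ.symm (WithLp.toLp 2 ![p 0, 0])))⁻¹ •
          (Real.sin (p 1) • b₁ + (Real.cos (p 1) - 1) • b₂) := by
  have sκi : SmoothAt U fun q => (κ q)⁻¹ := sκ.inv fun q hq => (hpos q hq).ne'
  have sn : SmoothAt U fun q => (κ q)⁻¹ • along w (along w X) q := sκi.smul h.smooth_W
  have dκi (u : Plane → Plane) : ∀ q ∈ U, along u (fun q => (κ q)⁻¹) q
      = -(κ q ^ 2)⁻¹ * along u κ q := fun q hq =>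
    along_comp (φ := fun y => y⁻¹) (hasDerivAt_inv (hpos q hq).ne') (sκ.diff hq)
  have dvn : ∀ q ∈ U, along v (fun q => (κ q)⁻¹ • along w (along w X) q) q = 0 := fun q hq => by
    have := (hpos q hq).ne'
    rw [along_smul (sκi.diff hq) (h.smooth_W.diff hq), dκi v q hq, hv q hq, h.v_W hq, smul_smul,
      ← add_smul]
    have e : -(κ q ^ 2)⁻¹ * (b q * κ q) + (κ q)⁻¹ * b q = 0 := by field_simp; ring
    rw [e, zero_smul]
  have dwn : ∀ q ∈ U, along w (fun q => (κ q)⁻¹ • along w (along w X) q) q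
      = -(κ q • along w X q) := fun q hq => by
    have := (hpos q hq).ne'
    rw [along_smul (sκi.diff hq) (h.smooth_W.diff hq), dκi w q hq, hw q hq, h.w_W hq, hW q hq]
    match_scalars
    · ring
    · field_simp
  have hx : x ∈ U := hχ.source_subset hχ.mem_source
  have tx : t x = 0 := by rw [← hχ.map_one, hχ.map_zero]; rfl
  have st := hχ.smooth_t
  have ssin : SmoothAt U fun q => Real.sin (t q) := fun q hq => (st q hq).sin
  have scos : SmoothAt U fun q => Real.cos (t q) := fun q hq => (st q hq).cos
  have dsin (u : Plane → Plane) : ∀ q ∈ U,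
      along u (fun q => Real.sin (t q)) q = Real.cos (t q) * along u t q := fun q hq =>
    along_comp (Real.hasDerivAt_sin _) (st.diff hq)
  have dcos (u : Plane → Plane) : ∀ q ∈ U,
      along u (fun q => Real.cos (t q)) q = -Real.sin (t q) * along u t q := fun q hq =>
    along_comp (Real.hasDerivAt_cos _) (st.diff hq)
  set n : Plane → R51 := fun q => (κ q)⁻¹ • along w (along w X) q with hn
  -- The pair `(E₂, n)` is constant along `v`, and along `κ⁻¹w` it satisfies `E₂' = n`, `n' = -E₂`.
  -- Rotating it back by the angle `t` gives constants.
  have hc1 : ∀ q ∈ U, Real.cos (t q) • along w X q - Real.sin (t q) • n q = along w X x := by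
    intro q hq
    have := h.eq_of_along_eq_zero hU ((scos.smul h.smooth_E₂).sub (ssin.smul sn))
      (fun q hq => by
        rw [along_sub ((scos.smul h.smooth_E₂).diff hq) ((ssin.smul sn).diff hq),
          along_smul (scos.diff hq) (h.smooth_E₂.diff hq), along_smul (ssin.diff hq) (sn.diff hq),
          dsin v q hq, dcos v q hq, hχ.along_v_t q hq, h.v_E₂ q hq, dvn q hq]
        simp)
      (fun q hq => by
        have hWn : along w (along w X) q = κ q • n q := by
          rw [hn, smul_smul, mul_inv_cancel₀ (hpos q hq).ne', one_smul]
        rw [along_sub ((scos.smul h.smooth_E₂).diff hq) ((ssin.smul sn).diff hq),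
          along_smul (scos.diff hq) (h.smooth_E₂.diff hq), along_smul (ssin.diff hq) (sn.diff hq),
          dsin w q hq, dcos w q hq, hχ.along_w_t q hq, dwn q hq, hWn]
        module) hq hx
    rw [this, tx]; simp
  have hc2 : ∀ q ∈ U, Real.sin (t q) • along w X q + Real.cos (t q) • n q = n x := by
    intro q hq
    have := h.eq_of_along_eq_zero hU ((ssin.smul h.smooth_E₂).add (scos.smul sn))
      (fun q hq => by
        rw [along_add ((ssin.smul h.smooth_E₂).diff hq) ((scos.smul sn).diff hq),
          along_smul (ssin.diff hq) (h.smooth_E₂.diff hq), along_smul (scos.diff hq) (sn.diff hq),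
          dsin v q hq, dcos v q hq, hχ.along_v_t q hq, h.v_E₂ q hq, dvn q hq]
        simp)
      (fun q hq => by
        have hWn : along w (along w X) q = κ q • n q := by
          rw [hn, smul_smul, mul_inv_cancel₀ (hpos q hq).ne', one_smul]
        rw [along_add ((ssin.smul h.smooth_E₂).diff hq) ((scos.smul sn).diff hq),
          along_smul (ssin.diff hq) (h.smooth_E₂.diff hq), along_smul (scos.diff hq) (sn.diff hq),
          dsin w q hq, dcos w q hq, hχ.along_w_t q hq, dwn q hq, hWn]
        module) hq hx
    rw [this, tx]; simp
  have hrot : ∀ q ∈ U, along w X q = Real.cos (t q) • along w X x - Real.sin (t q) • -n x ∧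
      n q = -(Real.sin (t q) • along w X x + Real.cos (t q) • -n x) := by
    intro q hq
    have hsc := Real.sin_sq_add_cos_sq (t q)
    rw [← hc1 q hq, ← hc2 q hq]
    generalize n q = m
    constructor <;> match_scalars <;>
      first | ring1 | linear_combination hsc | linear_combination -hsc
  -- The sign of the second vector makes `b₂` point from the centre `X + κ⁻¹n` of the circle to its
  -- point at `t = 0`.
  refine ⟨along w X x, -n x, ?_, h.E₂_E₂ hx, ?_, hrot, ?_⟩
  · rw [lorentz_neg_right, hn, lorentz_smul_right, lorentz_comm, h.along_E₂_E₂ hx]; simp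
  · have := (hpos x hx).ne'
    rw [lorentz_neg_left, lorentz_neg_right, hn, lorentz_smul_left, lorentz_smul_right, hW x hx]
    field_simp
  · intro p hp
    have hm := hχ.symm_mem hp
    have hm0 := hχ.symm_mem (IsAdaptedChart.toLp_mem_rect hχ.pos hp.1)
    -- The centre of the circle does not change along `w`; comparing it at `t` and at `0` gives the
    -- parametrization.
    have e1 := hχ.eq_of_along_w_eq_zero (g := fun q => X q + (κ q)⁻¹ • n q)
      (h.smooth.add (sκi.smul sn)) (fun q hq => by
        rw [along_add (h.smooth.diff hq) ((sκi.smul sn).diff hq),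
          along_smul (sκi.diff hq) (sn.diff hq), dwn q hq, dκi w q hq, hw q hq, smul_neg, smul_smul _ (κ q) _,
          inv_mul_cancel₀ (hpos q hq).ne']
        simp) hp
    have e2 := hχ.eq_of_along_w_eq_zero sκ hw hp
    have tp : t (Ψ.symm p) = p 1 := by
      rw [← hχ.map_one, Ψ.right_inv (hχ.target_eq ▸ hp)]
    have tp0 : t (Ψ.symm (WithLp.toLp 2 ![p 0, 0])) = 0 := by
      rw [← hχ.map_one, Ψ.right_inv (hχ.target_eq ▸ IsAdaptedChart.toLp_mem_rect hχ.pos hp.1)]; rfl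
    have n1 := (hrot _ hm).2
    have n0 := (hrot _ hm0).2
    rw [tp] at n1
    rw [tp0, Real.sin_zero, Real.cos_zero] at n0
    simp only at e1
    rw [n1, n0, e2] at e1
    rw [← sub_eq_zero] at e1 ⊢
    rw [← e1]
    module

end Coordinates

/-- The integration constants `c` and `C` of a surface. -/
def HasConstants (_ : IsPNMCFrame U X f b v w N) (c C : ℝ) : Prop := ∀ q ∈ U,
  lorentz (normalComponent X f v N q) (normalComponent X f v N q) = c ^ 2 * f q ^ 3 ∧
  lorentz (along w (along w X) q) (along w (along w X) q) = 9 * C * f q ^ (3 / 2 : ℝ) ∧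
  b q = √(radicand c C (f q))

lemma exists_parametrization (hU : Convex ℝ U) {c C : ℝ} (hC : 0 < C)
    (hcC : h.HasConstants c C) {x : Plane} (hx : x ∈ U) :
    ∃ (ε : ℝ) (Ψ : OpenPartialHomeomorph Plane Plane) (g κ : ℝ → ℝ) (b₁ b₂ : R51) (σ : ℝ → R51),
      0 < ε ∧ x ∈ Ψ.source ∧ Ψ.source ⊆ U ∧ Ψ.target = rect ε ε ∧ Ψ x = 0 ∧
      SmoothAt Ψ.source Ψ ∧ SmoothAt Ψ.target Ψ.symm ∧
      (∀ p ∈ rect ε ε, X (Ψ.symm p) =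
        σ (p 0) + (1 / κ (p 0)) • (Real.sin (p 1) • b₁ + (Real.cos (p 1) - 1) • b₂)) ∧
      (∀ p ∈ rect ε ε, f (Ψ.symm p) = g (p 0)) ∧
      (∀ u ∈ Set.Ioo (-ε) ε, 0 < g u ∧
        HasDerivAt g ((4 / 3) * g u * √(radicand c C (g u))) u ∧
        0 < (4 / 3) * g u * √(radicand c C (g u))) ∧
      (∀ u ∈ Set.Ioo (-ε) ε, κ u = 3 * √C * g u ^ (3 / 4 : ℝ)) ∧
      lorentz b₁ b₂ = 0 ∧ lorentz b₁ b₁ = 1 ∧ lorentz b₂ b₂ = 1 ∧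
      ContDiffOn ℝ ∞ σ (Set.Ioo (-ε) ε) ∧
      (∀ u ∈ Set.Ioo (-ε) ε,
        σ u ∈ H3 b₁ ∧ lorentz (deriv σ u) (deriv σ u) = 1 ∧
        curveCurvature σ u = g u * √(1 + c ^ 2 * g u) ∧
        curveTorsion σ u =
          2 * |c| * √(g u) / (3 * (1 + c ^ 2 * g u)) * √(radicand c C (g u)) ∧
        lorentz (σ u) b₂ = 1 / κ u) := by
  -- This is `|W|`, by the second first integral; positivity of `C` makes it nonzero.
  set k : Plane → ℝ := fun q => 3 * √C * f q ^ (3 / 4 : ℝ) with hk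
  have hCs := Real.sqrt_pos.2 hC
  have hf0 : ∀ q ∈ U, f q ≠ 0 := fun q hq => (h.f_pos q hq).ne'
  have sk : SmoothAt U k := (SmoothAt.const _).mul (h.smooth_f.rpow hf0 _)
  have kpos : ∀ q ∈ U, 0 < k q := fun q hq => by
    have := Real.rpow_pos_of_pos (h.f_pos q hq) (3 / 4)
    positivity
  have dk (u : Plane → Plane) : ∀ q ∈ U,
      along u k q = 3 * √C * along u (fun q => f q ^ (3 / 4 : ℝ)) q := fun q hq => by
    rw [hk, along_mul ((SmoothAt.const (U := U) (3 * √C)).diff hq) ((h.smooth_f.rpow hf0 _).diff hq),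
      along_const]
    ring
  have dvk : ∀ q ∈ U, along v k q = b q * k q := fun q hq => by
    rw [dk v q hq, h.v_rpow_f hq]; ring
  have dwk : ∀ q ∈ U, along w k q = 0 := fun q hq => by
    rw [dk w q hq, h.w_rpow_f hq, mul_zero]
  have hW : ∀ q ∈ U, lorentz (along w (along w X) q) (along w (along w X) q) = k q ^ 2 :=
    fun q hq => by
      have e1 : (f q ^ (3 / 4 : ℝ)) ^ 2 = f q ^ (3 / 2 : ℝ) := by
        rw [← Real.rpow_natCast, ← Real.rpow_mul (h.f_pos q hq).le]; norm_num
      rw [(hcC q hq).2.1, hk, mul_pow, mul_pow, Real.sq_sqrt hC.le, e1]; ring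
  obtain ⟨t, ε, Ψ, hχ⟩ := h.exists_adaptedChart hU sk kpos dvk hx
  obtain ⟨b₁, b₂, hb12, hb1, hb2, hrot, hpar⟩ :=
    h.rotation_const hU.isPreconnected hχ sk kpos dvk dwk hW
  let γ : ℝ → Plane := fun s => Ψ.symm (WithLp.toLp 2 ![s, 0])
  have hγ : ∀ s ∈ Set.Ioo (-ε) ε, γ s ∈ U := fun s hs =>
    hχ.symm_mem (IsAdaptedChart.toLp_mem_rect hχ.pos hs)
  -- On the directrix `t = 0`, so `b₁` is `E₂` and `b₂` is `-W/κ`. The two conditions on the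
  -- position of the curve then follow from `⟨E₂, X⟩ = 0` and `⟨W, X⟩ = -1`.
  have hline (s : ℝ) (hs : s ∈ Set.Ioo (-ε) ε) : along w X (γ s) = b₁ ∧
      (k (γ s))⁻¹ • along w (along w X) (γ s) = -b₂ := by
    have t0 : t (γ s) = 0 := by
      rw [← hχ.map_one, Ψ.right_inv (hχ.target_eq ▸ IsAdaptedChart.toLp_mem_rect hχ.pos hs)]; rfl
    have := hrot _ (hγ s hs)
    rw [t0] at this
    simpa using this
  have hev (s : ℝ) (hs : s ∈ Set.Ioo (-ε) ε) : Set.Ioo (-ε) ε ∈ nhds s := isOpen_Ioo.mem_nhds hs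
  have hd1 : ∀ s ∈ Set.Ioo (-ε) ε, deriv (fun s => X (γ s)) s = along v X (γ s) := fun s hs =>
    (hχ.hasDerivAt_line h.smooth hs).deriv
  have hd2 : ∀ s ∈ Set.Ioo (-ε) ε,
      deriv (deriv fun s => X (γ s)) s = along v (along v X) (γ s) := fun s hs => by
    have e : (deriv fun s => X (γ s)) =ᶠ[nhds s] fun s => along v X (γ s) :=
      Filter.eventually_of_mem (hev s hs) hd1
    rw [e.deriv_eq]
    exact (hχ.hasDerivAt_line h.smooth_E₁ hs).deriv
  have hcov : ∀ s ∈ Set.Ioo (-ε) ε, curveCov (fun s => X (γ s)) (deriv fun s => X (γ s)) s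
      = along v (along v X) (γ s) - X (γ s) := fun s hs => by
    rw [curveCov, hd2 s hs, hypProj, h.A_X (hγ s hs)]; module
  have hcurv : ∀ s ∈ Set.Ioo (-ε) ε, curveCurvature (fun s => X (γ s)) s
      = f (γ s) * √(1 + c ^ 2 * f (γ s)) := fun s hs => by
    have hf := h.f_pos _ (hγ s hs)
    rw [curveCurvature, hcov s hs, h.lorentz_A_sub_X (hγ s hs), (hcC _ (hγ s hs)).1,
      show c ^ 2 * f (γ s) ^ 3 + f (γ s) ^ 2 = f (γ s) ^ 2 * (1 + c ^ 2 * f (γ s)) by ring,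
      Real.sqrt_mul (sq_nonneg _), Real.sqrt_sq hf.le]
  have sT : SmoothAt U fun q => along v (along v X) q - X q := h.smooth_A.sub h.smooth
  have sg : SmoothAt U fun q => (f q * √(1 + c ^ 2 * f q))⁻¹ := by
    have hp : ∀ q ∈ U, 0 < 1 + c ^ 2 * f q := fun q hq => by
      have := h.f_pos q hq; positivity
    refine (h.smooth_f.mul (((SmoothAt.const 1).add ((SmoothAt.const _).mul h.smooth_f)).sqrt
      fun q hq => (hp q hq).ne')).inv fun q hq => ?_
    have := Real.sqrt_pos.2 (hp q hq)
    have := h.f_pos q hq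
    positivity
  have hnormal : ∀ s ∈ Set.Ioo (-ε) ε, deriv (curveNormal fun s => X (γ s)) s
      = along v (fun q => (f q * √(1 + c ^ 2 * f q))⁻¹ • (along v (along v X) q - X q)) (γ s) :=
    fun s hs => by
      have e : curveNormal (fun s => X (γ s)) =ᶠ[nhds s] fun s =>
          (f (γ s) * √(1 + c ^ 2 * f (γ s)))⁻¹ • (along v (along v X) (γ s) - X (γ s)) :=
        Filter.eventually_of_mem (hev s hs) fun r hr => by
          rw [curveNormal, hcurv r hr, hcov r hr]
      rw [e.deriv_eq]
      exact (hχ.hasDerivAt_line (sg.smul sT) hs).deriv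
  refine ⟨ε, Ψ, fun s => f (γ s), fun s => k (γ s), b₁, b₂, fun s => X (γ s), hχ.pos,
    hχ.mem_source, hχ.source_subset, hχ.target_eq, hχ.map_zero, hχ.smooth, hχ.smooth_symm,
    ?_, fun p hp => hχ.eq_of_along_w_eq_zero h.smooth_f h.along_w_eq hp, ?_, fun u hu => rfl,
    hb12, hb1, hb2, ?_, ?_⟩
  · intro p hp
    rw [hpar p hp, one_div]
  · intro s hs
    have hm := hγ s hs
    have hf := h.f_pos _ hm
    have hb := h.b_pos hm
    have h1 := hχ.hasDerivAt_line h.smooth_f hs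
    rw [h.along_f _ hm] at h1
    rw [(hcC _ hm).2.2] at h1 hb
    exact ⟨hf, h1, by positivity⟩
  · intro s hs
    have h1 : ContDiff ℝ ∞ fun s : ℝ => (WithLp.toLp 2 ![s, 0] : Plane) := by
      rw [contDiff_euclidean]
      intro i
      fin_cases i
      · exact contDiff_id
      · exact contDiff_const
    have hp := IsAdaptedChart.toLp_mem_rect hχ.pos hs
    exact ((h.smooth _ (hγ s hs)).comp s ((hχ.smooth_symm _ (hχ.target_eq ▸ hp)).comp s
      h1.contDiffAt)).contDiffWithinAt
  · intro s hs
    have hm := hγ s hs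
    have hf := h.f_pos _ hm
    have hb := h.b_pos hm
    obtain ⟨l1, l2⟩ := hline s hs
    refine ⟨⟨h.mem_H4 _ hm, ?_⟩, ?_, hcurv s hs, ?_, ?_⟩
    · rw [← l1, lorentz_comm]; exact h.E₂_X hm
    · rw [hd1 s hs]; exact h.E₁_E₁ hm
    · have hD : 0 < 1 + c ^ 2 * f (γ s) := by positivity
      have hr := Real.sqrt_pos.2 hD
      have hr2 : √(1 + c ^ 2 * f (γ s)) ^ 2 = 1 + c ^ 2 * f (γ s) := Real.sq_sqrt hD.le
      have hbin : curveBinormalPart (fun s => X (γ s)) s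
          = (2 * b (γ s) / (3 * (1 + c ^ 2 * f (γ s)))
              * (f (γ s) * √(1 + c ^ 2 * f (γ s)))⁻¹) •
            (normalComponent X f v N (γ s) + (c ^ 2 * f (γ s) ^ 2) • N (γ s)) := by
        have e := h.v_principalNormal hm (sq_nonneg c) (hcC _ hm).1
        have e' := eq_sub_of_add_eq e
        rw [curveBinormalPart, curveCov, hnormal s hs, hcurv s hs, hd1 s hs, ← e, hypProj]
        have hX : lorentz (along v (fun q => (f q * √(1 + c ^ 2 * f q))⁻¹ •
            (along v (along v X) q - X q)) (γ s)) (X (γ s)) = 0 := by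
          rw [e', lorentz_sub_left, lorentz_smul_left, lorentz_smul_left, lorentz_add_left,
            lorentz_smul_left, h.normalComponent_X hm, h.N_X _ hm, h.E₁_X hm]
          ring
        rw [hX, zero_smul, add_zero]
      rw [curveTorsion, hbin, h.lorentz_binormal hm (hcC _ hm).1, ← (hcC _ hm).2.2]
      have e3 : (2 * b (γ s) / (3 * (1 + c ^ 2 * f (γ s)))
          * (f (γ s) * √(1 + c ^ 2 * f (γ s)))⁻¹) ^ 2
          * (c ^ 2 * f (γ s) ^ 3 * (1 + c ^ 2 * f (γ s)))
          = (2 * b (γ s) / (3 * (1 + c ^ 2 * f (γ s)))) ^ 2 * (c ^ 2 * f (γ s)) := by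
        rw [mul_pow _ ((f (γ s) * √(1 + c ^ 2 * f (γ s)))⁻¹), inv_pow,
          mul_pow (f (γ s)), hr2]
        field_simp
      rw [e3, Real.sqrt_mul (sq_nonneg _), Real.sqrt_sq (by positivity),
        Real.sqrt_mul (sq_nonneg _), Real.sqrt_sq_eq_abs]
      ring
    · have hb2' : b₂ = -((k (γ s))⁻¹ • along w (along w X) (γ s)) := by rw [l2, neg_neg]
      rw [hb2', lorentz_neg_right, lorentz_smul_right, lorentz_comm, h.W_X hm]
      simp only [one_div]
      ring

end IsPNMCFrame

/-! ### Dependence of the invariants on germs only. -/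

section Germs

variable {X Y : Plane → R51} {q : Plane}

lemma pd_congr {F : Type*} [NormedAddCommGroup F] [NormedSpace ℝ F] {V W : Plane → F}
    (h : V =ᶠ[nhds q] W) (i : Fin 2) : pd i V =ᶠ[nhds q] pd i W :=
  h.fderiv.mono fun x hx => by simp only [pd]; rw [hx]

lemma meanCurv_congr (h : X =ᶠ[nhds q] Y) : meanCurv X q = meanCurv Y q := by
  have h1 (i : Fin 2) : pd i X q = pd i Y q := (pd_congr h i).eq_of_nhds
  have h2 (i j : Fin 2) : pd i (pd j X) q = pd i (pd j Y) q :=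
    (pd_congr (pd_congr h j) i).eq_of_nhds
  have h3 (i j : Fin 2) : gInv X q i j = gInv Y q i j := by simp only [gInv, gram, h1]
  simp only [meanCurv, meanCurvVec, secondFF, normPart, hypProj, tangPart, h1, h2, h3,
    h.eq_of_nhds]

lemma gradNorm_congr {f g : Plane → ℝ} (h : X =ᶠ[nhds q] Y) (hf : f =ᶠ[nhds q] g) :
    gradNorm X f q = gradNorm Y g q := by
  have h1 (i : Fin 2) : pd i X q = pd i Y q := (pd_congr h i).eq_of_nhds
  have h2 (i : Fin 2) : pd i f q = pd i g q := (pd_congr hf i).eq_of_nhds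
  simp only [gradNorm, gInv, gram, h1, h2]

lemma gradNorm_const (c : ℝ) : gradNorm X (fun _ => c) q = 0 := by
  simp [gradNorm, pd]

end Germs

/-! ### Passage from charts to the surface. -/

section Manifold

variable {M : Type*} [TopologicalSpace M] [ChartedSpace Plane M]

/-- The first integral at a single point, in all charts. -/
def FirstIntegralAt (Φ : M → R51) (c C : ℝ) (p : M) : Prop :=
  ∀ e ∈ charts M, p ∈ e.source →
    0 < radicand c C (meanCurv (Φ ∘ e.symm) (e p)) ∧
    gradNorm (Φ ∘ e.symm) (meanCurv (Φ ∘ e.symm)) (e p) =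
      (4 / 3) * meanCurv (Φ ∘ e.symm) (e p) * √(radicand c C (meanCurv (Φ ∘ e.symm) (e p)))

variable {e e' : OpenPartialHomeomorph M Plane}

lemma smoothAt_transition (he : e ∈ charts M) (he' : e' ∈ charts M) {p : M} (hp : p ∈ e.source)
    (hp' : p ∈ e'.source) : ContDiffAt ℝ ∞ (e ∘ e'.symm) (e' p) := by
  have h1 : ContMDiffAt (𝓡 2) (𝓡 2) ∞ e'.symm (e' p) :=
    contMDiffAt_symm_of_mem_maximalAtlas he' (e'.map_source hp')
  have h2 : ContMDiffAt (𝓡 2) (𝓡 2) ∞ e (e'.symm (e' p)) :=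
    contMDiffAt_of_mem_maximalAtlas he (by rwa [e'.left_inv hp'])
  exact contMDiffAt_iff_contDiffAt.1 (h2.comp (e' p) h1)

lemma fderiv_transition (he : e ∈ charts M) (he' : e' ∈ charts M) {p : M} (hp : p ∈ e.source)
    (hp' : p ∈ e'.source) (y : Plane) :
    fderiv ℝ (e ∘ e'.symm) (e' p) (fderiv ℝ (e' ∘ e.symm) (e p) y) = y := by
  have h1 : (e ∘ e'.symm) ∘ (e' ∘ e.symm) =ᶠ[nhds (e p)] id := by
    have h : ∀ᶠ x in nhds (e p), e.symm x ∈ e'.source :=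
      (e.continuousAt_symm (e.map_source hp)).eventually
        (e'.open_source.mem_nhds (by rwa [e.left_inv hp]))
    filter_upwards [h, e.open_target.mem_nhds (e.map_source hp)] with x hx hx'
    simp [e'.left_inv hx, e.right_inv hx']
  have hq : (e' ∘ e.symm) (e p) = e' p := by simp [e.left_inv hp]
  have h2 := fderiv_comp (e p) (g := e ∘ e'.symm) (f := e' ∘ e.symm)
    (by rw [hq]; exact (smoothAt_transition he he' hp hp').differentiableAt (by simp))
    ((smoothAt_transition he' he hp' hp).differentiableAt (by simp))
  rw [h1.fderiv_eq, hq, fderiv_id] at h2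
  exact (congrArg (fun L => L y) h2).symm

omit [ChartedSpace Plane M] in
lemma comp_transition (Φ : M → R51) {p : M} (hp : p ∈ e.source) (hp' : p ∈ e'.source) :
    Φ ∘ e'.symm =ᶠ[nhds (e' p)] (Φ ∘ e.symm) ∘ (e ∘ e'.symm) := by
  have h : ∀ᶠ x in nhds (e' p), e'.symm x ∈ e.source :=
    (e'.continuousAt_symm (e'.map_source hp')).eventually
      (e.open_source.mem_nhds (by rwa [e'.left_inv hp']))
  filter_upwards [h] with x hx
  simp [e.left_inv hx]

namespace IsPNMCBiconservative

variable {Φ : M → R51} (hΦ : IsPNMCBiconservative Φ)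

include hΦ

lemma isImmersionOn (he : e ∈ charts M) : IsImmersionOn e.target (Φ ∘ e.symm) where
  isOpen := e.open_target
  smooth q hq := by
    have h1 : ContMDiffAt (𝓡 2) (𝓡 2) ∞ e.symm q := contMDiffAt_symm_of_mem_maximalAtlas he hq
    exact contMDiffAt_iff_contDiffAt.1 ((hΦ.smooth (e.symm q)).comp q h1)
  mem_H4 q _ := hΦ.mem_H4 _
  injective q hq y hy := by
    have h1 : MDifferentiableAt (𝓡 2) (𝓡 2) e.symm q :=
      (contMDiffAt_symm_of_mem_maximalAtlas (n := ∞) he hq).mdifferentiableAt (by simp)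
    have h2 : MDifferentiableAt (𝓡 2) 𝓘(ℝ, R51) Φ (e.symm q) :=
      (hΦ.smooth (e.symm q)).mdifferentiableAt (by simp)
    have h3 : MDifferentiableAt (𝓡 2) (𝓡 2) e (e.symm q) :=
      (contMDiffAt_of_mem_maximalAtlas (n := ∞) he (e.map_target hq)).mdifferentiableAt (by simp)
    have h4 := mfderiv_comp q h2 h1
    rw [mfderiv_eq_fderiv] at h4
    have h5 := mfderiv_comp q h3 h1
    have h6 : (e ∘ e.symm) =ᶠ[nhds q] id :=
      Filter.eventually_of_mem (e.open_target.mem_nhds hq) fun x hx => e.right_inv hx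
    rw [h6.mfderiv_eq, mfderiv_id] at h5
    have h7 : mfderiv (𝓡 2) 𝓘(ℝ, R51) Φ (e.symm q) (mfderiv (𝓡 2) (𝓡 2) e.symm q y) = 0 := by
      rw [h4] at hy
      exact hy
    have h8 : mfderiv (𝓡 2) (𝓡 2) e.symm q y = 0 :=
      (injective_iff_map_eq_zero _).1 (hΦ.immersion (e.symm q)) _ h7
    have h9 : y = mfderiv (𝓡 2) (𝓡 2) e (e.symm q) (mfderiv (𝓡 2) (𝓡 2) e.symm q y) :=
      congrArg (fun L => L y) h5
    rw [h9, h8, map_zero]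
    rfl

lemma smooth_meanCurv (he : e ∈ charts M) : SmoothAt e.target (meanCurv (Φ ∘ e.symm)) :=
  (hΦ.isImmersionOn he).smooth_meanCurv (hΦ.meanCurv_pos e he)

lemma exists_gradientFrame (he : e ∈ charts M) :
    ∃ v w, IsGradientFrame e.target (Φ ∘ e.symm) (meanCurv (Φ ∘ e.symm)) v w := by
  have h := hΦ.isImmersionOn he
  obtain ⟨v, w, sv, sw, hvw⟩ := h.exists_frame (hΦ.smooth_meanCurv he) (hΦ.grad_ne_zero e he)
  refine ⟨v, w, h, hΦ.smooth_meanCurv he, sv, sw, fun q hq => (hvw q hq).1,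
    hΦ.meanCurv_pos e he, fun q hq => ?_, fun q hq => (hvw q hq).2.2⟩
  rw [(hvw q hq).2.1]
  exact lt_of_le_of_ne (Real.sqrt_nonneg _) (Ne.symm (hΦ.grad_ne_zero e he q hq))

lemma orthonormalAt_transition (he : e ∈ charts M) (he' : e' ∈ charts M) {p : M}
    (hp : p ∈ e.source) (hp' : p ∈ e'.source) : ∃ v w : Plane,
      OrthonormalAt (Φ ∘ e.symm) ((e ∘ e'.symm) (e' p)) (fderiv ℝ (e ∘ e'.symm) (e' p) v)
        (fderiv ℝ (e ∘ e'.symm) (e' p) w) := by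
  obtain ⟨v, w, h⟩ := hΦ.exists_gradientFrame he
  have h1 := h.orthonormal _ (e.map_source hp)
  refine ⟨fderiv ℝ (e' ∘ e.symm) (e p) (v (e p)), fderiv ℝ (e' ∘ e.symm) (e p) (w (e p)), ?_⟩
  rw [fderiv_transition he he' hp hp', fderiv_transition he he' hp hp']
  simpa [e'.left_inv hp'] using h1

lemma meanCurv_eq (he : e ∈ charts M) (he' : e' ∈ charts M) {p : M} (hp : p ∈ e.source)
    (hp' : p ∈ e'.source) :
    meanCurv (Φ ∘ e'.symm) (e' p) = meanCurv (Φ ∘ e.symm) (e p) := by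
  have hq : (e ∘ e'.symm) (e' p) = e p := by simp [e'.left_inv hp']
  obtain ⟨v, w, ho⟩ := hΦ.orthonormalAt_transition he he' hp hp'
  have h := hΦ.isImmersionOn he
  rw [meanCurv_congr (comp_transition Φ hp hp'), meanCurv,
    ho.meanCurvVec_comp (by rw [hq]; exact h.smooth _ (e.map_source hp))
      (smoothAt_transition he he' hp hp') (.of_forall fun x => hΦ.mem_H4 _), hq]
  rfl

lemma gradNorm_eq (he : e ∈ charts M) (he' : e' ∈ charts M) {p : M} (hp : p ∈ e.source)
    (hp' : p ∈ e'.source) :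
    gradNorm (Φ ∘ e'.symm) (meanCurv (Φ ∘ e'.symm)) (e' p)
      = gradNorm (Φ ∘ e.symm) (meanCurv (Φ ∘ e.symm)) (e p) := by
  have hq : (e ∘ e'.symm) (e' p) = e p := by simp [e'.left_inv hp']
  obtain ⟨v, w, ho⟩ := hΦ.orthonormalAt_transition he he' hp hp'
  have h := hΦ.isImmersionOn he
  have hf : meanCurv (Φ ∘ e'.symm) =ᶠ[nhds (e' p)]
      meanCurv (Φ ∘ e.symm) ∘ (e ∘ e'.symm) := by
    have h1 : ∀ᶠ x in nhds (e' p), e'.symm x ∈ e.source :=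
      (e'.continuousAt_symm (e'.map_source hp')).eventually
        (e.open_source.mem_nhds (by rwa [e'.left_inv hp']))
    filter_upwards [h1, e'.open_target.mem_nhds (e'.map_source hp')] with x hx hx'
    have := hΦ.meanCurv_eq he he' hx (e'.map_target hx')
    rwa [e'.right_inv hx'] at this
  rw [gradNorm_congr (comp_transition Φ hp hp') hf,
    ho.gradNorm_comp (by rw [hq]; exact h.smooth.diff (e.map_source hp))
      ((smoothAt_transition he he' hp hp').differentiableAt (by simp))
      (by rw [hq]; exact (hΦ.smooth_meanCurv he).diff (e.map_source hp)), hq]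

/-- In the chart carrying the frame, `|grad f| = (4/3) f b` with `b` the root of the radicand; chart
independence of `f` and `|grad f|` transfers this to every chart. -/
lemma firstIntegralAt (he : e ∈ charts M) {U : Set Plane} {b : Plane → ℝ}
    {v w : Plane → Plane} {N : Plane → R51}
    (h : IsPNMCFrame U (Φ ∘ e.symm) (meanCurv (Φ ∘ e.symm)) b v w N) {c C : ℝ}
    (hcC : h.HasConstants c C) {x : M} (hx : x ∈ e.source) (hxU : e x ∈ U) :
    FirstIntegralAt Φ c C x := by
  intro e' he' hx'
  rw [hΦ.meanCurv_eq he he' hx hx', hΦ.gradNorm_eq he he' hx hx', h.gradNorm_eq hxU,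
    (hcC _ hxU).2.2]
  refine ⟨?_, rfl⟩
  have := h.b_pos hxU
  rw [(hcC _ hxU).2.2] at this
  exact Real.sqrt_pos.1 this

variable [IsManifold (𝓡 2) ∞ M]

/-- The first integral determines its constants. -/
lemma constants_unique {p : M} {c C c' C' : ℝ} (hc : 0 < c) (hc' : 0 < c')
    (h : ∀ᶠ x in nhds p, FirstIntegralAt Φ c C x)
    (h' : ∀ᶠ x in nhds p, FirstIntegralAt Φ c' C' x) : c = c' ∧ C = C' := by
  have he : chartAt Plane p ∈ charts M := IsManifold.chart_mem_maximalAtlas p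
  have hp := mem_chart_source Plane p
  generalize chartAt Plane p = e at he hp
  have hpt := e.map_source hp
  have key : ∀ᶠ x in nhds (e p), x ∈ e.target ∧ 9 * (C - C')
      = (c ^ 2 - c' ^ 2) * meanCurv (Φ ∘ e.symm) x ^ (3 / 2 : ℝ) := by
    have hcont := (e.continuousAt_symm hpt).eventually
      (by rw [e.left_inv hp]; exact h.and h')
    filter_upwards [hcont, e.open_target.mem_nhds hpt] with x hx hxt
    obtain ⟨r1, g1⟩ := hx.1 e he (e.map_target hxt)
    obtain ⟨r2, g2⟩ := hx.2 e he (e.map_target hxt)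
    rw [e.right_inv hxt] at r1 g1 r2 g2
    have hf := hΦ.meanCurv_pos e he x hxt
    have e1 := mul_left_cancel₀ (by positivity) (g1.symm.trans g2)
    have e2 := (Real.sqrt_inj r1.le r2.le).1 e1
    have hp := Real.rpow_pos_of_pos hf (3 / 2)
    have e3 : (meanCurv (Φ ∘ e.symm) x ^ (3 / 2 : ℝ)) ^ 2 = meanCurv (Φ ∘ e.symm) x ^ 3 := by
      rw [← Real.rpow_natCast, ← Real.rpow_mul hf.le, ← Real.rpow_natCast]; norm_num
    simp only [radicand, ← e3] at e2
    refine ⟨hxt, mul_right_cancel₀ hp.ne' ?_⟩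
    linear_combination e2
  -- Otherwise the relation could be solved for `f^(3/2)`, and `f` would be constant near the point,
  -- against the nonvanishing gradient.
  have hcc : c ^ 2 = c' ^ 2 := by
    by_contra hne
    have hne' := sub_ne_zero.2 hne
    have hconst : meanCurv (Φ ∘ e.symm) =ᶠ[nhds (e p)]
        fun _ => (9 * (C - C') / (c ^ 2 - c' ^ 2)) ^ (2 / 3 : ℝ) := by
      filter_upwards [key] with x hx
      have hf := hΦ.meanCurv_pos e he x hx.1
      rw [hx.2, mul_div_cancel_left₀ _ hne', ← Real.rpow_mul hf.le]
      norm_num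
    apply hΦ.grad_ne_zero e he _ hpt
    rw [gradNorm_congr Filter.EventuallyEq.rfl hconst, gradNorm_const]
  refine ⟨(pow_left_inj₀ hc.le hc'.le two_ne_zero).1 hcc, ?_⟩
  have := key.self_of_nhds.2
  rw [hcc, sub_self, zero_mul] at this
  linarith

/-- A PNMC frame around every point, with its integration constants. -/
lemma exists_frame_constants (p : M) : ∃ e ∈ charts M, p ∈ e.source ∧
    ∃ U ⊆ e.target, e p ∈ U ∧ Convex ℝ U ∧ ∃ (b : Plane → ℝ) (v w : Plane → Plane)
      (N : Plane → R51) (h : IsPNMCFrame U (Φ ∘ e.symm) (meanCurv (Φ ∘ e.symm)) b v w N)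
      (c C : ℝ), 0 < c ∧ h.HasConstants c C := by
  have he : chartAt Plane p ∈ charts M := IsManifold.chart_mem_maximalAtlas p
  have hp := mem_chart_source Plane p
  generalize chartAt Plane p = e at he hp
  obtain ⟨r, hr, hsub⟩ := Metric.isOpen_iff.1 e.open_target _ (e.map_source hp)
  obtain ⟨v, w, hg⟩ := hΦ.exists_gradientFrame he
  have hg' : IsGradientFrame (Metric.ball (e p) r) (Φ ∘ e.symm) (meanCurv (Φ ∘ e.symm)) v w :=
    { hg.toIsImmersionOn.mono Metric.isOpen_ball hsub with
      smooth_f := hg.smooth_f.mono hsub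
      smooth_v := hg.smooth_v.mono hsub
      smooth_w := hg.smooth_w.mono hsub
      orthonormal := fun q hq => hg.orthonormal q (hsub hq)
      f_pos := fun q hq => hg.f_pos q (hsub hq)
      along_v_pos := fun q hq => hg.along_v_pos q (hsub hq)
      along_w_eq := fun q hq => hg.along_w_eq q (hsub hq) }
  have h := (hg'.isBiconservativeFrame (fun q hq => hΦ.parallel e he q (hsub hq))
    (fun q hq => hΦ.biconservative e he q (hsub hq))).isPNMCFrame
  have hconv : Convex ℝ (Metric.ball (e p) r) := convex_ball _ _
  have hx : e p ∈ Metric.ball (e p) r := Metric.mem_ball_self hr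
  obtain ⟨k, C, hkC⟩ := h.exists_constants hconv.isPreconnected
  have hf := h.f_pos _ hx
  have hk0 : 0 ≤ k := by
    have := h.normalComponent_self_nonneg hx
    rw [(hkC _ hx).1] at this
    exact nonneg_of_mul_nonneg_left this (by positivity)
  -- For `k = 0` the vector `L` is null and orthogonal to `X`, hence zero; an open piece would then
  -- lie in a totally geodesic hypersurface, which fullness excludes.
  have hk : 0 < k := by
    refine lt_of_le_of_ne hk0 fun hk => ?_
    obtain ⟨ν, hν, hX⟩ := h.exists_totallyGeodesic hconv.isPreconnected hx fun q hq =>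
      eq_zero_of_lorentz_self (h.mem_H4 q hq) (h.normalComponent_X hq)
        (by rw [(hkC q hq).1, ← hk, zero_mul])
    refine hΦ.full (e.source ∩ e ⁻¹' Metric.ball (e p) r)
      (e.isOpen_inter_preimage Metric.isOpen_ball) ⟨p, hp, hx⟩ ⟨ν, hν, fun x hx => ?_⟩
    have := hX _ hx.2
    rw [Function.comp_apply, e.left_inv hx.1] at this
    exact ⟨hΦ.mem_H4 x, this⟩
  refine ⟨e, he, hp, _, hsub, hx, hconv, _, v, w, _, h, √k, C, Real.sqrt_pos.2 hk,
    fun q hq => ?_⟩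
  rw [Real.sq_sqrt hk0]
  refine ⟨(hkC q hq).1, (hkC q hq).2.1, ?_⟩
  rw [radicand, Real.sq_sqrt hk0, ← (hkC q hq).2.2, Real.sqrt_sq (h.b_pos hq).le]

end IsPNMCBiconservative

lemma trans_mem_charts [IsManifold (𝓡 2) ∞ M] (he : e ∈ charts M) {Ψ : OpenPartialHomeomorph Plane Plane}
    (h1 : SmoothAt Ψ.source Ψ) (h2 : SmoothAt Ψ.target Ψ.symm) : e.trans Ψ ∈ charts M := by
  refine OpenPartialHomeomorph.mem_maximalAtlas_of_contMDiffOn _ ?_ ?_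
  · intro x hx
    rw [e.trans_source] at hx
    have ha : ContMDiffAt (𝓡 2) (𝓡 2) ∞ e x := contMDiffAt_of_mem_maximalAtlas he hx.1
    have hb : ContMDiffAt (𝓡 2) (𝓡 2) ∞ Ψ (e x) := contMDiffAt_iff_contDiffAt.2 (h1 _ hx.2)
    exact (hb.comp x ha).contMDiffWithinAt
  · intro x hx
    rw [e.trans_target] at hx
    have ha : ContMDiffAt (𝓡 2) (𝓡 2) ∞ e.symm (Ψ.symm x) :=
      contMDiffAt_symm_of_mem_maximalAtlas he hx.2
    have hb : ContMDiffAt (𝓡 2) (𝓡 2) ∞ Ψ.symm x := contMDiffAt_iff_contDiffAt.2 (h2 _ hx.1)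
    exact (ha.comp x hb).contMDiffWithinAt

end Manifold

end HypSurface

end

/-! ### Globalization of the constants and assembly of the theorem. -/

theorem mainTheorem2 {M : Type*} [TopologicalSpace M] [ConnectedSpace M]
    [ChartedSpace HypSurface.Plane M] [IsManifold (𝓡 2) ∞ M]
    (Φ : M → HypSurface.R51) (hΦ : HypSurface.IsPNMCBiconservative Φ) :
    ∃ c C : ℝ, c ≠ 0 ∧ HypSurface.HasFirstIntegral Φ c C ∧
      (0 < C → ∀ p : M,
        ∃ e ∈ HypSurface.charts M, ∃ (ε δ : ℝ) (f κ : ℝ → ℝ) (b₁ b₂ : HypSurface.R51)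
          (σ : ℝ → HypSurface.R51),
          0 < ε ∧ 0 < δ ∧ p ∈ e.source ∧ e p = 0 ∧
          e.target = {q : HypSurface.Plane | q 0 ∈ Set.Ioo (-ε) ε ∧ q 1 ∈ Set.Ioo (-δ) δ} ∧
          -- the local parametrization
          (∀ q ∈ e.target, Φ (e.symm q) =
            σ (q 0) + (1 / κ (q 0)) • (Real.sin (q 1) • b₁ + (Real.cos (q 1) - 1) • b₂)) ∧
          -- `f` is the mean curvature function and solves the first-order equation
          (∀ q ∈ e.target, HypSurface.meanCurv (Φ ∘ e.symm) q = f (q 0)) ∧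
          (∀ u ∈ Set.Ioo (-ε) ε, 0 < f u ∧
            HasDerivAt f ((4 / 3) * f u * √(HypSurface.radicand c C (f u))) u ∧
            0 < (4 / 3) * f u * √(HypSurface.radicand c C (f u))) ∧
          (∀ u ∈ Set.Ioo (-ε) ε, κ u = 3 * √C * f u ^ (3 / 4 : ℝ)) ∧
          -- the constant vectors
          HypSurface.lorentz b₁ b₂ = 0 ∧ HypSurface.lorentz b₁ b₁ = 1 ∧
          HypSurface.lorentz b₂ b₂ = 1 ∧
          -- the directrix curve
          ContDiffOn ℝ ∞ σ (Set.Ioo (-ε) ε) ∧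
          (∀ u ∈ Set.Ioo (-ε) ε,
            σ u ∈ HypSurface.H3 b₁ ∧
            HypSurface.lorentz (deriv σ u) (deriv σ u) = 1 ∧
            HypSurface.curveCurvature σ u = f u * √(1 + c ^ 2 * f u) ∧
            HypSurface.curveTorsion σ u =
              2 * |c| * √(f u) / (3 * (1 + c ^ 2 * f u)) * √(HypSurface.radicand c C (f u)) ∧
            HypSurface.lorentz (σ u) b₂ = 1 / κ u)) := by
  choose e he hpe U hUe hpU hconv b v w N h c C hc hcC using hΦ.exists_frame_constants
  have hV (p : M) : (e p).source ∩ e p ⁻¹' U p ∈ nhds p :=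
    ((e p).isOpen_inter_preimage (h p).isOpen).mem_nhds ⟨hpe p, hpU p⟩
  have hFI (p : M) : ∀ᶠ x in nhds p, HypSurface.FirstIntegralAt Φ (c p) (C p) x :=
    Filter.eventually_of_mem (hV p) fun x hx =>
      hΦ.firstIntegralAt (he p) (h p) (hcC p) hx.1 hx.2
  -- The constants chosen at `x` near `p` and those chosen at `p` both satisfy the first integral
  -- near `x`, so they agree by uniqueness. The choice of positive `c` removes the sign ambiguity.
  have hloc : IsLocallyConstant fun p => (c p, C p) := by
    rw [IsLocallyConstant.iff_eventually_eq]
    intro p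
    filter_upwards [(hFI p).eventually_nhds] with x hx
    obtain ⟨h1, h2⟩ := hΦ.constants_unique (hc x) (hc p) (hFI x) hx
    rw [h1, h2]
  obtain ⟨p₀⟩ := (inferInstance : Nonempty M)
  have hcp (p : M) : c p = c p₀ := congrArg Prod.fst (hloc.apply_eq_of_preconnectedSpace p p₀)
  have hCp (p : M) : C p = C p₀ := congrArg Prod.snd (hloc.apply_eq_of_preconnectedSpace p p₀)
  refine ⟨c p₀, C p₀, (hc p₀).ne', fun e' he' q hq => ?_, fun hC p => ?_⟩
  · have := (hFI (e'.symm q)).self_of_nhds e' he' (e'.map_target hq)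
    rwa [e'.right_inv hq, hcp, hCp] at this
  · obtain ⟨ε, Ψ, g, κ, b₁, b₂, σ, hε, hx, hsub, htar, h0, s1, s2, hpar, hf, hg, hκ, b12, b11, b22,
      hσ, hcurve⟩ := (h p).exists_parametrization (hconv p) (by rw [hCp]; exact hC) (hcC p) (hpU p)
    rw [hcp, hCp] at hg
    rw [hcp, hCp] at hcurve
    rw [hCp] at hκ
    have hmem := HypSurface.trans_mem_charts (he p) s1 s2
    have htar' : ((e p).trans Ψ).target = HypSurface.rect ε ε := by
      rw [(e p).trans_target, htar, Set.inter_eq_left]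
      exact fun q hq => hUe p (hsub (Ψ.map_target (htar ▸ hq)))
    refine ⟨(e p).trans Ψ, hmem, ε, ε, g, κ, b₁, b₂, σ, hε, hε, ⟨hpe p, hx⟩, h0, htar', ?_, ?_, hg, hκ,
      b12, b11, b22, hσ, hcurve⟩
    · intro q hq
      exact hpar q (htar' ▸ hq)
    · intro q hq
      have hs := ((e p).trans Ψ).map_target hq
      -- The mean curvature was computed in the frame's chart; it is carried over to the adapted
      -- chart by chart independence.
      have h1 := hΦ.meanCurv_eq (he p) hmem hs.1 hs
      rw [((e p).trans Ψ).right_inv hq] at h1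
      rw [h1, ← hf q (htar' ▸ hq)]
      have hq' : q ∈ Ψ.target := by rw [htar, ← htar']; exact hq
      congr 1
      exact (e p).right_inv (hUe p (hsub (Ψ.map_target hq')))
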